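/- Let $\sigma_0$ be a finite relational vocabulary all of whose relation symbols are unary or binary. Let $\mathscr C_0$ be a free amalgamation class of finite $\sigma_0$-structures: a nonempty class of finite structures, closed under substructures and isomorphic copies, such that for any embeddings $M\hookrightarrow N$, $M\hookrightarrow P$ between members of $\mathscr C_0$ the free amalgam of $N$ and $P$ over $M$ (the union of $N$ and $P$ with intersection exactly $M$, and with no related tuples except those of $N$ and of $P$) is again in $\mathscr C_0$. Assume that every binary relation of $\sigma_0$ is irreflexive in every member of $\mathscr C_0$. Let $\mathscr C$ be the class of all $(\sigma_0\uplus\{<\})$-structures obtained from members of $\mathscr C_0$ by interpreting $<$ as an arbitrary (strict) total order, and let $\mathbb A$ be the Fraïssé limit of $\mathscr C$. Let $\mathbb F$ be a field, $S\subset\mathbb A$ a finite set and $d\ge 0$ an integer. Write $\operatorname{Aut}(\mathbb A/S)$ for the group of automorphisms of $\mathbb A$ that fix every element of $S$; it acts on $\mathbb A^d$ componentwise. Let $\mathcal O=\operatorname{Aut}(\mathbb A/S)\cdot o\subseteq\mathbb A^d$ be an $S$-ordered orbit, that is, the orbit of a tuple $o=(o_1,\dots,o_d)$ with $o_i\notin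 S$ for all $i$ and $o_1<\dots<o_d$. Let $\operatorname{Lin}_{\mathbb F}\mathcal O$ be the vector space of finite formal $\mathbb F$-linear combinations of elements of $\mathcal O$, with the induced linear action of $\operatorname{Aut}(\mathbb A/S)$. Then the length of $\operatorname{Lin}_{\mathbb F}\mathcal O$, i.e. the supremum of all $l$ for which there is a chain $W_0\subsetneq W_1\subsetneq\dots\subsetneq W_l$ of $\operatorname{Aut}(\mathbb A/S)$-equivariant linear subspaces of $\operatorname{Lin}_{\mathbb F}\mathcal O$, is exactly $2^d$. (For $S=\emptyset$ this concerns ordered orbits under the full automorphism group and equivariant subspaces.) -/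

import Mathlib

universe u v w

open FirstOrder FirstOrder.Language

namespace GenericOrder

/-! ### Vocabularies and classes of finite structures -/

/-- The relation symbols form a finite set and are all unary or binary. (That there are no function
symbols is expressed by `L₀.IsRelational`.) -/
structure IsGraphVocabulary (L₀ : FirstOrder.Language.{u, v}) : Prop where
  finite : Finite (Σ n, L₀.Relations n)
  arity : ∀ n, Nonempty (L₀.Relations n) → n = 1 ∨ n = 2

/-- The free amalgamation property: any two embeddings `M ↪ N`, `M ↪ P` between members of the
class are completed to a commuting square by the free amalgam of `N` and `P` over `M`, and this
amalgam belongs to the class. The free amalgam is the union of its copies of `N` and `P`, these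
copies meet exactly in the copy of `M`, and every related tuple lies inside one of the copies. -/
def FreeAmalgamation {L₀ : FirstOrder.Language.{u, v}} (K : Set (CategoryTheory.Bundled.{w} L₀.Structure)) :
    Prop :=
  ∀ (M N P : CategoryTheory.Bundled.{w} L₀.Structure) (MN : M ↪[L₀] N) (MP : M ↪[L₀] P),
    M ∈ K → N ∈ K → P ∈ K →
    ∃ (Q : CategoryTheory.Bundled.{w} L₀.Structure) (NQ : N ↪[L₀] Q) (PQ : P ↪[L₀] Q),
      Q ∈ K ∧ NQ.comp MN = PQ.comp MP ∧
      Set.range NQ ∪ Set.range PQ = Set.univ ∧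
      (∀ (n : N) (p : P), NQ n = PQ p → ∃ m : M, MN m = n ∧ MP m = p) ∧
      ∀ (k : ℕ) (R : L₀.Relations k) (x : Fin k → Q), Structure.RelMap R x →
        (∀ i, x i ∈ Set.range NQ) ∨ (∀ i, x i ∈ Set.range PQ)

/-- A free amalgamation class of finite structures: nonempty, closed under substructures and
isomorphic copies (this is `Hereditary`), with the free amalgamation property. Joint embedding is
amalgamation over the empty structure, and over a finite relational vocabulary there are
automatically only countably many isomorphism types. -/
structure IsFreeAmalgamationClass {L₀ : FirstOrder.Language.{u, v}}
    (K : Set (CategoryTheory.Bundled.{w} L₀.Structure)) : Prop where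
  nonempty : K.Nonempty
  finite : ∀ M ∈ K, Finite M
  hereditary : Hereditary K
  freeAmalgamation : FreeAmalgamation K

/-- All structures of the class interpret every binary symbol by an irreflexive relation. -/
def IrreflexiveClass {L₀ : FirstOrder.Language.{u, v}}
    (K : Set (CategoryTheory.Bundled.{w} L₀.Structure)) : Prop :=
  ∀ M ∈ K, ∀ (R : L₀.Relations 2) (x : M), ¬ Structure.RelMap R ![x, x]

/-! ### Generically ordered expansions -/

/-- The relation symbols of the vocabulary `{<}`. -/
inductive LtSymbol : ℕ → Type
  | lt : LtSymbol 2

/-- The vocabulary `{<}` with one binary relation symbol. -/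
def ltLanguage : FirstOrder.Language.{0, 0} := ⟨fun _ => Empty, LtSymbol⟩

instance : ltLanguage.IsRelational := fun _ => (inferInstance : IsEmpty Empty)

/-- The vocabulary `σ₀ ⊎ {<}`. -/
abbrev withLt (L₀ : FirstOrder.Language.{u, v}) : FirstOrder.Language.{u, v} := L₀.sum ltLanguage

/-- The symbol `<` of the vocabulary `σ₀ ⊎ {<}`. -/
def ltSymb (L₀ : FirstOrder.Language.{u, v}) : (withLt L₀).Relations 2 :=
  Sum.inr LtSymbol.lt

/-- The interpretation of the symbol `<`. -/
def Lt (L₀ : FirstOrder.Language.{u, v}) {A : Type w} [(withLt L₀).Structure A] (a b : A) : Prop :=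
  Structure.RelMap (ltSymb L₀) ![a, b]

/-- The class of all structures over `σ₀ ⊎ {<}` whose `σ₀`-reduct belongs to `K` and in which `<`
is a (strict) total order. -/
def orderedExpansions {L₀ : FirstOrder.Language.{u, v}}
    (K : Set (CategoryTheory.Bundled.{w} L₀.Structure)) :
    Set (CategoryTheory.Bundled.{w} (withLt L₀).Structure) :=
  {M | (⟨M, (LHom.sumInl : L₀ →ᴸ withLt L₀).reduct M⟩ :
      CategoryTheory.Bundled.{w} L₀.Structure) ∈ K ∧ IsStrictTotalOrder M (Lt L₀)}

/-! ### Automorphisms and ordered orbits -/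

/-- The group `Aut(A/S)` of the automorphisms of the structure `A` that fix every element of `S`,
as a group of permutations of `A`. -/
def autFixing (L : FirstOrder.Language.{u, v}) {A : Type w} [L.Structure A] (S : Set A) :
    Subgroup (Equiv.Perm A) where
  carrier := {g | (∃ e : A ≃[L] A, e.toEquiv = g) ∧ ∀ s ∈ S, g s = s}
  one_mem' := ⟨⟨FirstOrder.Language.Equiv.refl L A, rfl⟩, fun _ _ => rfl⟩
  mul_mem' := by
    rintro _ _ ⟨⟨e, rfl⟩, he⟩ ⟨⟨f, rfl⟩, hf⟩
    exact ⟨⟨e.comp f, rfl⟩, fun s hs => by rw [Equiv.Perm.mul_apply, hf s hs, he s hs]⟩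
  inv_mem' := by
    rintro _ ⟨⟨e, rfl⟩, he⟩
    exact ⟨⟨e.symm, rfl⟩, fun s hs => by rw [Equiv.Perm.inv_eq_iff_eq, he s hs]⟩

/-- A tuple is `S`-ordered if its entries avoid `S` and are strictly increasing. -/
def IsOrderedTuple (L₀ : FirstOrder.Language.{u, v}) {A : Type w} [(withLt L₀).Structure A] (S : Set A)
    {d : ℕ} (a : Fin d → A) : Prop :=
  (∀ i, a i ∉ S) ∧ ∀ i j, i < j → Lt L₀ (a i) (a j)

/-! ### Spaces of formal linear combinations and their length -/

/-- The vector space `Lin_F X` of finite formal linear combinations of elements of a `G`-set `X`,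
with the action `g (∑ i, c i • x i) = ∑ i, c i • (g x i)`. -/
noncomputable def linRep (F : Type*) [Field F] (G : Type*) [Group G] (X : Type*) [MulAction G X] :
    Representation F G (X →₀ F) where
  toFun g := Finsupp.lmapDomain F F (fun x => g • x)
  map_one' := by ext; simp
  map_mul' g h := by ext; simp [mul_smul]

/-- The length of `Lin_F X`: the supremum of the lengths `l` of the strictly increasing chains
`W₀ < W₁ < ⋯ < W_l` of `G`-equivariant subspaces. -/
noncomputable def linLength (F : Type*) [Field F] (G : Type*) [Group G] (X : Type*)
    [MulAction G X] : WithBot ℕ∞ :=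
  Order.krullDim (Subrepresentation (linRep F G X))

end GenericOrder

/-! For a set I of coordinates, call a combination of I-tuples a cycle if it vanishes whenever one
coordinate is forgotten. List the 2^d sets of coordinates along a linear extension of inclusion and
filter Lin O by the vectors whose projections to all earlier sets vanish. Projection to I embeds the
quotient at I into the cycles on I, because every I \ {i} comes earlier. It remains to see that each
quotient is nonzero and simple; `krullDim_subrepresentation_eq` then counts them.

A cog is the expansion of ∏ (a_i - b_i) where every mixture of a and b has the type of o. Lifting a
cog to full tuples shows that the quotients are nonzero (`exists_proj_ne_zero`). Simplicity rests on
three facts. (1) Cycles are spanned by cogs (`IsCycle.mem_cogSpan`), by induction on |I|. If one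
point b can replace the last coordinate of all supporting tuples at once, the cycle is the sum, over
its slices with fixed last coordinate, of slice minus slice moved to b, and each slice is a cycle in
one coordinate less. Such a b exists once the points in the support have no accidental coincidences
or relations; these are removed by replacing one vertex at a time by a generic copy. (2) An
invariant subspace with a nonzero vector contains a free cog, one with a_j < b_j unrelated for all j
(`exists_cog_mem`): repeatedly subtract the image under an automorphism moving a single entry. (3)
Free cogs form one orbit (`IsCog.exists_map`) and span all cogs (`cog_mem_of_free`).

These arguments use only the axioms `IsPairGeneric`, chiefly one-point extension. That axiom comes
from free amalgamation: in a binary vocabulary, membership in the class can be tested on cliques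
(`IsFreeAmalgamationClass.mem_of_cliques`), so a new point has to be consistent only on pairwise
related sets, while its cut in the order is arbitrary. -/

namespace GenericOrder

/-! ### Replacing a coordinate, and cogs -/

section Cogs

variable {A ι : Type*} (F : Type*) [Field F] [DecidableEq ι]

/-- The linear map replacing the `i`-th entry of every tuple by `x`. -/
noncomputable def upd (i : ι) (x : A) : ((ι → A) →₀ F) →ₗ[F] ((ι → A) →₀ F) :=
  Finsupp.lmapDomain F F fun a => Function.update a i x

/-- The formal expansion of the product of the `a i - b i` over `i ∈ I`, with the other entries
taken from `a`. -/
noncomputable def cog (I : Finset ι) (a b : ι → A) : (ι → A) →₀ F :=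
  ∑ e ∈ I.powerset, (-1 : F) ^ e.card • Finsupp.single (e.piecewise b a) 1

variable {F}

@[simp]
theorem upd_single (i : ι) (x : A) (a : ι → A) (r : F) :
    upd F i x (Finsupp.single a r) = Finsupp.single (Function.update a i x) r := by
  simp [upd]

@[simp]
theorem upd_upd (i : ι) (x y : A) (v : (ι → A) →₀ F) : upd F i x (upd F i y v) = upd F i x v := by
  induction v using Finsupp.induction_linear with
  | zero => simp
  | add v w hv hw => simp [hv, hw]
  | single a r => simp

theorem upd_comm {i j : ι} (h : i ≠ j) (x y : A) (v : (ι → A) →₀ F) :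
    upd F i x (upd F j y v) = upd F j y (upd F i x v) := by
  induction v using Finsupp.induction_linear with
  | zero => simp
  | add v w hv hw => simp [hv, hw]
  | single a r => simp [Function.update_comm h]

/-- The subsets of `insert i I` split by whether they contain `i`. This is the recursion by which
cogs gain a factor. -/
theorem cog_insert {I : Finset ι} {i : ι} (hi : i ∉ I) (a b : ι → A) :
    cog F (insert i I) a b = cog F I a b - upd F i (b i) (cog F I a b) := by
  rw [cog, Finset.sum_powerset_insert hi, cog, map_sum, sub_eq_add_neg, ← Finset.sum_neg_distrib]
  congr 1
  refine Finset.sum_congr rfl fun e he => ?_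
  have : i ∉ e := fun h => hi (Finset.mem_powerset.1 he h)
  rw [Finset.card_insert_of_notMem this, Finset.piecewise_insert, map_smul, upd_single, pow_succ]
  simp

theorem cog_update_right {I : Finset ι} {i : ι} (hi : i ∉ I) (a b : ι → A) (x : A) :
    cog F I a (Function.update b i x) = cog F I a b := by
  refine Finset.sum_congr rfl fun e he => ?_
  have : i ∉ e := fun h => hi (Finset.mem_powerset.1 he h)
  congr 2
  ext j
  by_cases hj : j ∈ e
  · have : j ≠ i := by rintro rfl; contradiction
    simp [hj, this]
  · simp [hj]

theorem cog_update_left {I : Finset ι} {i : ι} (hi : i ∉ I) (a b : ι → A) (x : A) :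
    cog F I (Function.update a i x) b = upd F i x (cog F I a b) := by
  rw [cog, cog, map_sum]
  refine Finset.sum_congr rfl fun e he => ?_
  have : i ∉ e := fun h => hi (Finset.mem_powerset.1 he h)
  rw [map_smul, upd_single, Finset.update_piecewise_of_notMem _ _ _ this]

/-- Multilinearity: `a i - b i = (a i - x) - (b i - x)`. -/
theorem cog_split {I : Finset ι} {i : ι} (hi : i ∈ I) (a b : ι → A) (x : A) :
    cog F I a b = cog F I a (Function.update b i x) -
      cog F I (Function.update a i (b i)) (Function.update b i x) := by
  have h := Finset.notMem_erase i I
  rw [← Finset.insert_erase hi, cog_insert h, cog_insert h, cog_insert h, cog_update_right h,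
    cog_update_right h, cog_update_left h]
  simp

/-- This is why the slice of a cycle at a fixed i-th entry is still killed by forgetting any other
coordinate. -/
theorem upd_filter [DecidableEq A] {i j : ι} (hij : i ≠ j) (x y : A) (v : (ι → A) →₀ F) :
    upd F j y (v.filter fun a => a i = x) = (upd F j y v).filter fun a => a i = x := by
  induction v using Finsupp.induction_linear with
  | zero => rw [map_zero, Finsupp.filter_zero, map_zero]
  | add v w hv hw => simp [Finsupp.filter_add, hv, hw]
  | single a r =>
    by_cases h : a i = x
    · rw [Finsupp.filter_single_of_pos (fun a : ι → A => a i = x) h, upd_single,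
        Finsupp.filter_single_of_pos]
      simp [hij, h]
    · rw [Finsupp.filter_single_of_neg (fun a : ι → A => a i = x) h, upd_single,
        Finsupp.filter_single_of_neg]
      · simp
      · simp [hij, h]

end Cogs

/-! ### Pair types and the axioms of a generic ordered binary structure -/

section PairTypes

variable {A τ ι F : Type*} [LinearOrder A] (c : A → A → τ)

/-- The type of a pair: its colour together with the order between the two points. -/
def pairType (x y : A) : τ × Prop × Prop := (c x y, x < y, y < x)

variable {c}

theorem pairType_eq_iff {x y x' y' : A} :
    pairType c x y = pairType c x' y' ↔
      c x y = c x' y' ∧ (x < y ↔ x' < y') ∧ (y < x ↔ y' < x') := by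
  simp [pairType]

theorem pairType_lt {x y x' y' : A} (h : pairType c x y = pairType c x' y') :
    x < y ↔ x' < y' := (pairType_eq_iff.1 h).2.1

/-- The order is total, so equality means that neither strict inequality holds. Hence types also
control coincidences between points. -/
theorem pairType_eq {x y x' y' : A} (h : pairType c x y = pairType c x' y') :
    x = y ↔ x' = y' := by
  obtain ⟨-, h1, h2⟩ := pairType_eq_iff.1 h
  rw [eq_iff_le_not_lt, eq_iff_le_not_lt, ← not_lt, ← not_lt, h1, h2]

/-- A linearly ordered set with coloured pairs that behaves like the Fraïssé limit of generically
ordered structures in a binary vocabulary with free amalgamation: `G` is its automorphism group,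
finite partial isomorphisms extend to elements of `G`, and one can add a point which looks like
`a₀` over (the image under `q` of) a set `R`, is unrelated to everything else, and lies in a
prescribed cut. -/
structure IsPairGeneric (c : A → A → τ) (unrel : A → A → Prop)
    (G : Subgroup (Equiv.Perm A)) : Prop where
  c_symm : ∀ {x y x' y'}, c x y = c x' y' → c y x = c y' x'
  c_diag : ∀ {x y x' y'}, c x y = c x' y' → c x x = c x' x'
  unrel_symm : ∀ {x y}, unrel x y → unrel y x
  unrel_self : ∀ x, unrel x x
  c_of_unrel : ∀ {x y x' y'}, unrel x y → unrel x' y' → c x x = c x' x' → c y y = c y' y' →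
    c x y = c x' y'
  map_c : ∀ {g}, g ∈ G → ∀ x y, c (g x) (g y) = c x y
  map_lt : ∀ {g}, g ∈ G → ∀ x y, g x < g y ↔ x < y
  hom : ∀ P : Set (A × A), P.Finite →
    (∀ p ∈ P, ∀ q ∈ P, c p.1 q.1 = c p.2 q.2 ∧ (p.1 < q.1 ↔ p.2 < q.2)) →
    ∃ g ∈ G, ∀ p ∈ P, g p.1 = p.2
  ext : ∀ (X R L : Set A) (q : A → A) (a₀ : A), X.Finite → R ⊆ X →
    (∀ x ∈ X, ∀ y ∈ X, y < x → x ∈ L → y ∈ L) →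
    (∀ y ∈ R, c (q y) (q y) = c y y) →
    (∀ y ∈ R, ∀ z ∈ R, ¬ unrel y z → c (q y) (q z) = c y z) →
    ∃ b ∉ X, c b b = c a₀ a₀ ∧ (∀ y ∈ R, c b y = c a₀ (q y)) ∧ (∀ y ∈ X, y ∉ R → unrel b y) ∧
      ∀ y ∈ X, (y < b ↔ y ∈ L)

variable {unrel : A → A → Prop} {G : Subgroup (Equiv.Perm A)}

theorem IsPairGeneric.pairType_symm (hG : IsPairGeneric c unrel G) {x y x' y' : A}
    (h : pairType c x y = pairType c x' y') : pairType c y x = pairType c y' x' := by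
  obtain ⟨h0, h1, h2⟩ := pairType_eq_iff.1 h
  exact pairType_eq_iff.2 ⟨hG.c_symm h0, h2, h1⟩

theorem IsPairGeneric.pairType_self (hG : IsPairGeneric c unrel G) {x y x' y' : A}
    (h : c x y = c x' y') : pairType c x x = pairType c x' x' :=
  pairType_eq_iff.2 ⟨hG.c_diag h, by simp, by simp⟩

theorem IsPairGeneric.pairType_map (hG : IsPairGeneric c unrel G) {g : Equiv.Perm A} (hg : g ∈ G)
    (x y : A) : pairType c (g x) (g y) = pairType c x y :=
  pairType_eq_iff.2 ⟨hG.map_c hg x y, hG.map_lt hg x y, hG.map_lt hg y x⟩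

variable (c)

/-- The tuples `a` and `o` have the same type over `S`. -/
def SameType (S : Set A) (o a : ι → A) : Prop :=
  (∀ j k, pairType c (a j) (a k) = pairType c (o j) (o k)) ∧
    ∀ j, ∀ s ∈ S, pairType c (a j) s = pairType c (o j) s

/-- A pair of tuples every mixture of which has the same type over `S` as `o`. -/
def IsCog (S : Set A) (o a b : ι → A) : Prop :=
  ∀ j x, x = a j ∨ x = b j → pairType c x x = pairType c (o j) (o j) ∧
    (∀ s ∈ S, pairType c x s = pairType c (o j) s) ∧
    ∀ k y, k ≠ j → y = a k ∨ y = b k → pairType c x y = pairType c (o j) (o k)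

/-- A strictly increasing tuple avoiding `S`. -/
def IsIncreasing [Preorder ι] (S : Set A) (o : ι → A) : Prop :=
  StrictMono o ∧ ∀ i, o i ∉ S

variable {c} {S : Set A} {o a b : ι → A}

theorem SameType.refl (S : Set A) (o : ι → A) : SameType c S o o :=
  ⟨fun _ _ => rfl, fun _ _ _ => rfl⟩

theorem SameType.isIncreasing [Preorder ι] (h : SameType c S o a) (ho : IsIncreasing S o) :
    IsIncreasing S a :=
  ⟨fun j k hjk => (pairType_lt (h.1 j k)).2 (ho.1 hjk), fun i hi =>
    ho.2 i (by rw [(pairType_eq (h.2 i _ hi)).1 rfl]; exact hi)⟩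

theorem IsCog.sameType [DecidableEq ι] (h : IsCog c S o a b) (e : Finset ι) :
    SameType c S o (e.piecewise b a) := by
  have hm : ∀ j, e.piecewise b a j = a j ∨ e.piecewise b a j = b j := fun j => by
    by_cases hj : j ∈ e <;> simp [hj]
  refine ⟨fun j k => ?_, fun j => (h j _ (hm j)).2.1⟩
  rcases eq_or_ne k j with rfl | hkj
  · exact (h k _ (hm k)).1
  · exact (h j _ (hm j)).2.2 k _ hkj (hm k)

theorem SameType.isCog (h : SameType c S o a) : IsCog c S o a a := by
  rintro j x hx
  obtain rfl : x = a j := by tauto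
  refine ⟨h.1 j j, h.2 j, ?_⟩
  rintro k y hk hy
  obtain rfl : y = a k := by tauto
  exact h.1 j k

theorem IsPairGeneric.exists_map (hG : IsPairGeneric c unrel G) [Finite ι] (hS : S.Finite)
    (h : SameType c S o a) : ∃ g ∈ G, (∀ s ∈ S, g s = s) ∧ ∀ i, g (o i) = a i := by
  obtain ⟨g, hg, h'⟩ := hG.hom ((fun s => (s, s)) '' S ∪ Set.range fun i => (o i, a i))
    ((hS.image _).union (Set.finite_range _)) (by
      rintro _ (⟨s, hs, rfl⟩ | ⟨i, rfl⟩) _ (⟨t, ht, rfl⟩ | ⟨j, rfl⟩)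
      · simp
      · have := pairType_eq_iff.1 (hG.pairType_symm (h.2 j s hs))
        exact ⟨this.1.symm, this.2.1.symm⟩
      · have := pairType_eq_iff.1 (h.2 i t ht)
        exact ⟨this.1.symm, this.2.1.symm⟩
      · have := pairType_eq_iff.1 (h.1 i j)
        exact ⟨this.1.symm, this.2.1.symm⟩)
  exact ⟨g, hg, fun s hs => h' (s, s) (.inl ⟨s, hs, rfl⟩), fun i => h' (o i, a i) (.inr ⟨i, rfl⟩)⟩

theorem IsPairGeneric.sameType_map (hG : IsPairGeneric c unrel G) {g : Equiv.Perm A} (hg : g ∈ G)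
    (hgS : ∀ s ∈ S, g s = s) (h : SameType c S o a) : SameType c S o fun i => g (a i) :=
  ⟨fun j k => (hG.pairType_map hg _ _).trans (h.1 j k), fun j s hs => by
    rw [← h.2 j s hs, ← hG.pairType_map hg (a j) s, hgS s hs]⟩

/-! ### Cycles and the span of cogs -/

section Cycles

variable [Field F] [DecidableEq ι]

variable (F c) in
/-- The span of the cogs of tuples with the type of `o` over `S`, in the coordinates in `I`, the
other coordinates being those of `o`. -/
noncomputable def cogSpan (S : Set A) (I : Finset ι) (o : ι → A) : Submodule F ((ι → A) →₀ F) :=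
  Submodule.span F {u | ∃ a b, IsCog c S o a b ∧ (∀ j ∉ I, a j = o j ∧ b j = o j) ∧
    u = cog F I a b}

variable (F c) in
/-- The vectors supported on tuples with the type of `o` over `S` agreeing with `o` outside `I`
that are killed by forgetting any coordinate in `I`. -/
structure IsCycle (S : Set A) (I : Finset ι) (o : ι → A) (v : (ι → A) →₀ F) : Prop where
  sameType : ∀ a ∈ v.support, SameType c S o a
  agree : ∀ a ∈ v.support, ∀ j ∉ I, a j = o j
  killed : ∀ j ∈ I, ∀ x, upd F j x v = 0

/-- Moving the entry `x` in coordinate `i` to `x'` changes a cycle by a combination of cogs, if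
cycles in one coordinate less are combinations of cogs. -/
theorem IsCycle.replace (hG : IsPairGeneric c unrel G) [LinearOrder ι] {I : Finset ι} {i : ι}
    (hi : i ∈ I) (hS : S.Finite) (ho : IsIncreasing S o)
    (ih : ∀ (S' : Set A) (o' : ι → A) (w : (ι → A) →₀ F), S'.Finite → IsIncreasing S' o' →
      IsCycle F c S' (I.erase i) o' w → w ∈ cogSpan F c S' (I.erase i) o')
    {v : (ι → A) →₀ F} (hv : IsCycle F c S I o v) {x x' : A} (hx : x ≠ x')
    (hx' : ∀ a ∈ v.support, a i = x → SameType c S o (Function.update a i x')) :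
    (v.filter fun a => a i = x) - upd F i x' (v.filter fun a => a i = x) ∈ cogSpan F c S I o := by
  set w := v.filter fun a => a i = x with hw
  have hws : ∀ a ∈ w.support, a ∈ v.support ∧ a i = x := fun a ha => by
    simpa [hw, Finsupp.support_filter] using ha
  rcases eq_or_ne w 0 with h0 | h0
  · simp [h0]
  obtain ⟨o', ho'⟩ := Finsupp.support_nonempty_iff.2 h0
  obtain ⟨ho'v, ho'x⟩ := hws o' ho'
  have h1 := hv.sameType o' ho'v
  have h2 := hx' o' ho'v ho'x
  have key : ∀ j, j ≠ i → pairType c (o' j) x' = pairType c (o j) (o i) := fun j hj => by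
    simpa [hj] using h2.1 j i
  -- The slice at `x` is a cycle in the coordinates `I.erase i`. Adding `x'` to the base makes the
  -- cogs supplied by induction compatible with `x'` as well as with `x`.
  have hmem : w ∈ cogSpan F c (insert x' S) (I.erase i) o' := by
    refine ih _ _ _ (hS.insert x') ⟨(h1.isIncreasing ho).1, fun j => ?_⟩ ⟨?_, ?_, ?_⟩
    · rw [Set.mem_insert_iff, not_or]
      refine ⟨?_, (h1.isIncreasing ho).2 j⟩
      rcases eq_or_ne j i with rfl | hj
      · rwa [ho'x]
      · intro h
        exact hj (ho.1.injective ((pairType_eq (key j hj)).1 h))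
    · intro a ha
      obtain ⟨hav, hax⟩ := hws a ha
      have h3 := hv.sameType a hav
      refine ⟨fun j k => (h3.1 j k).trans (h1.1 j k).symm, ?_⟩
      rintro j s (rfl | hs)
      · rcases eq_or_ne j i with rfl | hj
        · rw [hax, ho'x]
        · rw [key j hj]
          simpa [hj] using (hx' a hav hax).1 j i
      · exact (h3.2 j s hs).trans (h1.2 j s hs).symm
    · intro a ha j hj
      obtain ⟨hav, hax⟩ := hws a ha
      rcases eq_or_ne j i with rfl | hji
      · rw [hax, ho'x]
      · have : j ∉ I := fun h => hj (Finset.mem_erase.2 ⟨hji, h⟩)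
        rw [hv.agree a hav j this, hv.agree o' ho'v j this]
    · intro j hj y
      rw [upd_filter (Finset.ne_of_mem_erase hj).symm, hv.killed j (Finset.mem_of_mem_erase hj),
        Finsupp.filter_zero]
  -- By `cog_insert`, `id - upd i x'` multiplies a cog by the factor `x - x'` in coordinate `i`.
  have hmap : cogSpan F c (insert x' S) (I.erase i) o' ≤
      (cogSpan F c S I o).comap (LinearMap.id - upd F i x') := by
    refine Submodule.span_le.2 ?_
    rintro _ ⟨a, b, hab, hoff, rfl⟩
    refine Submodule.subset_span ⟨a, Function.update b i x', ?_, ?_, ?_⟩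
    · have hai : a i = o' i := (hoff i (by simp)).1
      have hnew : ∀ j y, j ≠ i → y = a j ∨ y = Function.update b i x' j →
          pairType c y x' = pairType c (o j) (o i) := fun j y hj hy => by
        rw [← key j hj]
        exact (hab j y (by simpa [hj] using hy)).2.1 x' (Set.mem_insert _ _)
      have hold : ∀ j y, y = a j ∨ (j ≠ i ∧ y = b j) →
          pairType c y y = pairType c (o j) (o j) ∧
          (∀ s ∈ S, pairType c y s = pairType c (o j) s) ∧
          ∀ k z, k ≠ j → (z = a k ∨ z = b k) → pairType c y z = pairType c (o j) (o k) :=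
        fun j y hy => by
          have := hab j y (by tauto)
          exact ⟨this.1.trans (h1.1 j j), fun s hs => (this.2.1 s (.inr hs)).trans (h1.2 j s hs),
            fun k z hk hz => (this.2.2 k z hk hz).trans (h1.1 j k)⟩
      intro j y hy
      by_cases hjy : j = i ∧ y = x'
      · obtain ⟨rfl, rfl⟩ := hjy
        refine ⟨by simpa using h2.1 j j, fun s hs => by simpa using h2.2 j s hs,
          fun k z hk hz => hG.pairType_symm (hnew k z hk hz)⟩
      · have hy' : y = a j ∨ (j ≠ i ∧ y = b j) := by
          rcases eq_or_ne j i with rfl | hj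
          · simp only [Function.update_self] at hy
            tauto
          · simp only [Function.update_of_ne hj] at hy
            tauto
        obtain ⟨e1, e2, e3⟩ := hold j y hy'
        refine ⟨e1, e2, fun k z hk hz => ?_⟩
        rcases eq_or_ne k i with rfl | hki
        · rw [Function.update_self] at hz
          rcases hz with rfl | rfl
          · exact e3 _ _ hk (.inl rfl)
          · exact hnew j y hk.symm (by rcases hy' with h | ⟨h, h'⟩ <;> simp [*])
        · exact e3 k z hk (by simpa [hki] using hz)
    · intro j hj
      have hji : j ≠ i := by rintro rfl; contradiction
      have := hoff j (fun h => hj (Finset.mem_of_mem_erase h))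
      rw [Function.update_of_ne hji, this.1, this.2, hv.agree o' ho'v j hj]
      exact ⟨rfl, rfl⟩
    · rw [← Finset.insert_erase hi, Finset.erase_insert (Finset.notMem_erase i I),
        cog_insert (Finset.notMem_erase i I), cog_update_right (Finset.notMem_erase i I)]
      simp
  simpa using hmap hmem

end Cycles

end PairTypes

theorem sum_filter_eq {A ι F : Type*} [DecidableEq A] [DecidableEq (ι → A)] [Field F]
    (i : ι) (v : (ι → A) →₀ F) :
    ∑ x ∈ v.support.image (fun a => a i), v.filter (fun a => a i = x) = v := by
  ext a
  rw [Finsupp.finsetSum_apply]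
  simp only [Finsupp.filter_apply, Finset.sum_ite_eq]
  split_ifs with h
  · rfl
  · by_contra h'
    exact h (Finset.mem_image_of_mem (fun a : ι → A => a i)
      (Finsupp.mem_support_iff.2 (Ne.symm h')))

/-! ### Cycles are spanned by cogs -/

section Generation

variable {A τ ι F : Type*} [LinearOrder A] {c : A → A → τ} {unrel : A → A → Prop}
  {G : Subgroup (Equiv.Perm A)} [Field F] [LinearOrder ι] {S : Set A} {o a : ι → A}

theorem IsPairGeneric.sameType_update (hG : IsPairGeneric c unrel G) (h : SameType c S o a) {i : ι}
    {x : A} (hx : c x x = c (o i) (o i))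
    (hxa : ∀ j, j ≠ i → pairType c x (a j) = pairType c (o i) (o j))
    (hxS : ∀ s ∈ S, pairType c x s = pairType c (o i) s) :
    SameType c S o (Function.update a i x) := by
  refine ⟨fun j k => ?_, fun j s hs => ?_⟩
  · rcases eq_or_ne j i with rfl | hj <;> rcases eq_or_ne k j with rfl | hk
    · simpa using hG.pairType_self hx
    · simpa [hk] using hxa k hk
    · simpa [hj] using h.1 k k
    · rcases eq_or_ne k i with rfl | hki
      · simpa [hj] using hG.pairType_symm (hxa j hj)
      · simpa [hj, hki] using h.1 j k
  · rcases eq_or_ne j i with rfl | hj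
    · simpa using hxS s hs
    · simpa [hj] using h.2 j s hs

theorem IsCycle.pairType_base {I : Finset ι} {v : (ι → A) →₀ F} (hv : IsCycle F c S I o v)
    (ha : a ∈ v.support) (j : ι) {t : A} (ht : t ∈ S ∪ o '' {j | j ∉ I}) :
    pairType c (a j) t = pairType c (o j) t := by
  rcases ht with ht | ⟨k, hk, rfl⟩
  · exact (hv.sameType a ha).2 j t ht
  · have := (hv.sameType a ha).1 j k
    rwa [hv.agree a ha k hk] at this

theorem IsIncreasing.notMem_base {I : Finset ι} (ho : IsIncreasing S o) {i : ι} (hi : i ∈ I) :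
    o i ∉ S ∪ o '' {j | j ∉ I} := by
  rintro (h | ⟨k, hk, h⟩)
  · exact ho.2 i h
  · exact hk (ho.1.injective h ▸ hi)

theorem IsCycle.notMem_base {I : Finset ι} {v : (ι → A) →₀ F} (ho : IsIncreasing S o)
    (hv : IsCycle F c S I o v) (ha : a ∈ v.support) {j : ι} (hj : j ∈ I) :
    a j ∉ S ∪ o '' {j | j ∉ I} := fun h => by
  refine ho.notMem_base hj ?_
  rw [(pairType_eq (hv.pairType_base ha j h)).1 rfl]
  exact h

/-- The entries in coordinates in `I` of the tuples supporting `v`, with their coordinates. -/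
noncomputable def vertices (I : Finset ι) (v : (ι → A) →₀ F) : Finset (ι × A) :=
  v.support.biUnion fun a => I.image fun i => (i, a i)

theorem mem_vertices {I : Finset ι} {v : (ι → A) →₀ F} {p : ι × A} :
    p ∈ vertices I v ↔ ∃ a ∈ v.support, p.1 ∈ I ∧ a p.1 = p.2 := by
  simp only [vertices, Finset.mem_biUnion, Finset.mem_image]
  constructor
  · rintro ⟨a, ha, i, hi, rfl⟩
    exact ⟨a, ha, hi, rfl⟩
  · rintro ⟨a, ha, hi, h⟩
    exact ⟨a, ha, p.1, hi, by rw [h]⟩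

/-- The points occurring in `P` are distinct for distinct coordinates, and related only if they are
related as the corresponding entries of `o` are; they do not occur in `v` outside `P`. -/
structure IsClean (c : A → A → τ) (unrel : A → A → Prop) (o : ι → A) (I : Finset ι)
    (v : (ι → A) →₀ F) (P : Finset (ι × A)) : Prop where
  subset : P ⊆ vertices I v
  ne : ∀ p ∈ P, ∀ q ∈ vertices I v, p ≠ q → p.2 ≠ q.2
  related : ∀ p ∈ P, ∀ q ∈ P, p ≠ q → ¬ unrel p.2 q.2 →
    p.1 ≠ q.1 ∧ c p.2 q.2 = c (o p.1) (o q.1)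

/-- Without accidental coincidences or relations, the vertices outside the last coordinate `m` of
`I` can be sent to the entries of `o` by a map preserving colours of related pairs. So a single
point `b` can stand to all of them as `o m` stands to the entries of `o`, and `replace` applies to
every slice with the same target `b`. -/
theorem IsCycle.mem_cogSpan_of_clean (hG : IsPairGeneric c unrel G) {I : Finset ι}
    (hI : I.Nonempty) (hS : S.Finite) (hfin : Finite ι) (ho : IsIncreasing S o)
    (ih : ∀ i ∈ I, ∀ (S' : Set A) (o' : ι → A) (w : (ι → A) →₀ F), S'.Finite →
      IsIncreasing S' o' → IsCycle F c S' (I.erase i) o' w → w ∈ cogSpan F c S' (I.erase i) o')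
    {v : (ι → A) →₀ F} (hv : IsCycle F c S I o v)
    (hP : IsClean c unrel o I v (vertices I v)) : v ∈ cogSpan F c S I o := by
  classical
  set m := I.max' hI with hm
  have hmI : m ∈ I := I.max'_mem hI
  set T : Set A := S ∪ o '' {j | j ∉ I} with hT
  set N : Set A := {x | ∃ j, j ≠ m ∧ (j, x) ∈ vertices I v} with hN
  -- Sends a vertex to the entry of `o` in its coordinate and fixes the base. Cleanness makes the
  -- coordinate of a vertex unique.
  let q : A → A := fun x => if h : x ∈ N then o h.choose else x
  have hqV : ∀ j x, j ≠ m → (j, x) ∈ vertices I v → q x = o j := fun j x hj hx => by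
    have h : x ∈ N := ⟨j, hj, hx⟩
    have h' := h.choose_spec
    have : h.choose = j := by
      by_contra hne
      exact hP.ne (h.choose, x) h'.2 (j, x) hx (by simpa using hne) rfl
    simp only [q, dif_pos h, this]
  have hVT : ∀ p ∈ vertices I v, p.2 ∉ T := fun p hp => by
    obtain ⟨a, ha, hi, h⟩ := mem_vertices.1 hp
    exact h ▸ hv.notMem_base ho ha hi
  have hqT : ∀ t ∈ T, q t = t := fun t ht => by
    have : t ∉ N := fun ⟨j, _, hj⟩ => hVT _ hj ht
    simp only [q, dif_neg this]
  have hVt : ∀ p ∈ vertices I v, ∀ t ∈ T, pairType c p.2 t = pairType c (o p.1) t :=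
    fun p hp t ht => by
      obtain ⟨a, ha, hi, h⟩ := mem_vertices.1 hp
      exact h ▸ hv.pairType_base ha _ ht
  -- The cut is the top of the interval between base points that contains `o m`. Since `m` is the
  -- largest coordinate in `I`, this puts `b` above every vertex of the other coordinates.
  obtain ⟨b, hbX, hbb, hbR, -, hbL⟩ := hG.ext (T ∪ Prod.snd '' (vertices I v : Set (ι × A)))
    (T ∪ N) {y | ∀ t ∈ T, o m < t → y < t} q (o m)
    ((hS.union (Set.toFinite _)).union ((vertices I v).finite_toSet.image _))
    (Set.union_subset_union_right _ (by rintro x ⟨j, -, hj⟩; exact ⟨_, hj, rfl⟩))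
    (fun x _ y _ hyx hx t ht h => hyx.trans (hx t ht h))
    (by
      rintro y (hy | ⟨j, hj, hy⟩)
      · rw [hqT y hy]
      · rw [hqV j y hj hy]
        obtain ⟨a, ha, hi, h⟩ := mem_vertices.1 hy
        have := (pairType_eq_iff.1 ((hv.sameType a ha).1 j j)).1
        simp only at h
        rw [← this, h])
    (by
      have hTN : ∀ t ∈ T, ∀ j x, j ≠ m → (j, x) ∈ vertices I v → c (q x) (q t) = c x t := by
        intro t ht j x hj hx
        rw [hqT t ht, hqV j x hj hx]
        exact (pairType_eq_iff.1 (hVt _ hx t ht)).1.symm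
      rintro y (hy | ⟨j, hj, hy⟩) z (hz | ⟨k, hk, hz⟩) hyz
      · rw [hqT y hy, hqT z hz]
      · exact hG.c_symm (hTN y hy k z hk hz)
      · exact hTN z hz j y hj hy
      · rw [hqV j y hj hy, hqV k z hk hz]
        have hne : ((j, y) : ι × A) ≠ (k, z) := by
          rintro h
          obtain ⟨rfl, rfl⟩ := Prod.mk.inj h
          exact hyz (hG.unrel_self _)
        exact (hP.related _ hy _ hz hne hyz).2.symm)
  have hbT : ∀ t ∈ T, pairType c b t = pairType c (o m) t := by
    intro t ht
    have h1 : t < b ↔ t < o m := by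
      rw [hbL t (.inl ht)]
      constructor
      · intro h
        by_contra hlt
        rcases (not_lt.1 hlt).lt_or_eq with h' | h'
        · exact lt_irrefl _ (h t ht h')
        · exact ho.notMem_base hmI (h' ▸ ht)
      · exact fun h t' _ ht' => h.trans ht'
    have hbt : t ≠ b := by rintro rfl; exact hbX (.inl ht)
    have hot : t ≠ o m := by rintro rfl; exact ho.notMem_base hmI ht
    refine pairType_eq_iff.2 ⟨by rw [hbR t (.inl ht), hqT t ht], ?_, h1⟩
    rw [← not_iff_not, not_lt, not_lt, hbt.le_iff_lt, hot.le_iff_lt, h1]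
  have hbV : ∀ j x, j ≠ m → (j, x) ∈ vertices I v → pairType c b x = pairType c (o m) (o j) := by
    intro j x hj hx
    have hjm : o j < o m := by
      obtain ⟨a, ha, hi, h⟩ := mem_vertices.1 hx
      exact ho.1 (lt_of_le_of_ne (I.le_max' j hi) hj)
    have hxb : x < b := (hbL x (.inr ⟨_, hx, rfl⟩)).2 fun t ht h =>
      (pairType_lt (hVt _ hx t ht)).2 (hjm.trans h)
    refine pairType_eq_iff.2 ⟨?_, iff_of_false hxb.not_gt hjm.not_gt, iff_of_true hxb hjm⟩
    rw [hbR x (.inr ⟨j, hj, hx⟩), hqV j x hj hx]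
  have hupd : ∀ a ∈ v.support, SameType c S o (Function.update a m b) := by
    intro a ha
    refine hG.sameType_update (hv.sameType a ha) hbb (fun j hj => ?_) fun s hs => hbT s (.inl hs)
    by_cases hjI : j ∈ I
    · exact hbV j _ hj (mem_vertices.2 ⟨a, ha, hjI, rfl⟩)
    · rw [hv.agree a ha j hjI]
      exact hbT _ (.inr ⟨j, hjI, rfl⟩)
  -- The subtracted terms add up to `upd F m b v`, which is zero for a cycle.
  have hsum : v = ∑ x ∈ v.support.image (fun a => a m),
      ((v.filter fun a => a m = x) - upd F m b (v.filter fun a => a m = x)) := by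
    rw [Finset.sum_sub_distrib, ← map_sum, sum_filter_eq, hv.killed m hmI, sub_zero]
  rw [hsum]
  refine Submodule.sum_mem _ fun x hx => ?_
  obtain ⟨a, ha, rfl⟩ := Finset.mem_image.1 hx
  refine hv.replace hG hmI hS ho (ih m hmI) ?_ fun a' ha' _ => hupd a' ha'
  rintro h
  exact hbX (.inr ⟨(m, a m), mem_vertices.2 ⟨a, ha, hmI, rfl⟩, h⟩)

/-- Replace an unclean vertex `x` by a fresh copy `x'` that keeps only the relations to the base and
to points sharing a supporting tuple with `x`. By `replace` this changes `v` by a combination of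
cogs, and the number of unclean vertices drops. -/
theorem IsCycle.exists_cleaner (hG : IsPairGeneric c unrel G) {I : Finset ι}
    (hS : S.Finite) (hfin : Finite ι) (ho : IsIncreasing S o)
    (ih : ∀ i ∈ I, ∀ (S' : Set A) (o' : ι → A) (w : (ι → A) →₀ F), S'.Finite →
      IsIncreasing S' o' → IsCycle F c S' (I.erase i) o' w → w ∈ cogSpan F c S' (I.erase i) o')
    {v : (ι → A) →₀ F} (hv : IsCycle F c S I o v) {P : Finset (ι × A)}
    (hP : IsClean c unrel o I v P) {i : ι} {x : A} (hx : (i, x) ∈ vertices I v \ P) :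
    ∃ (v' : (ι → A) →₀ F) (P' : Finset (ι × A)), IsCycle F c S I o v' ∧
      IsClean c unrel o I v' P' ∧ (vertices I v' \ P').card < (vertices I v \ P).card ∧
      v - v' ∈ cogSpan F c S I o := by
  classical
  obtain ⟨hxV, hxP⟩ := Finset.mem_sdiff.1 hx
  obtain ⟨a₀, ha₀, hi, ha₀x⟩ := mem_vertices.1 hxV
  simp only at hi ha₀x
  set T : Set A := S ∪ o '' {j | j ∉ I} with hT
  set N : Set A := {y | ∃ a ∈ v.support, a i = x ∧ ∃ j ∈ I, j ≠ i ∧ a j = y} with hN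
  have hxT : x ∉ T := ha₀x ▸ hv.notMem_base ho ha₀ hi
  -- The cut directly above `x` gives `x'` the same order relations as `x` to every point of `T ∪
  -- N`.
  obtain ⟨x', hx'X, hx'x', hx'R, hx'u, hx'L⟩ := hG.ext
    (T ∪ Prod.snd '' (vertices I v : Set (ι × A))) (T ∪ N) {y | y ≤ x} id x
    ((hS.union (Set.toFinite _)).union ((vertices I v).finite_toSet.image _))
    (Set.union_subset_union_right _ (by
      rintro y ⟨a, ha, -, j, hj, -, rfl⟩
      exact ⟨(j, a j), mem_vertices.2 ⟨a, ha, hj, rfl⟩, rfl⟩))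
    (fun y _ z _ hzy hy => hzy.le.trans hy) (fun _ _ => rfl) (fun _ _ _ _ _ => rfl)
  have hVX : ∀ p ∈ vertices I v, x' ≠ p.2 := by
    rintro p hp rfl
    exact hx'X (.inr ⟨p, hp, rfl⟩)
  have hpt : ∀ y ∈ T ∪ N, pairType c x' y = pairType c x y := by
    intro y hy
    have hyX : y ∈ T ∪ Prod.snd '' (vertices I v : Set (ι × A)) := by
      rcases hy with hy | ⟨a, ha, -, j, hj, -, rfl⟩
      · exact .inl hy
      · exact .inr ⟨(j, a j), mem_vertices.2 ⟨a, ha, hj, rfl⟩, rfl⟩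
    have hyx : y ≠ x := by
      rcases hy with hy | ⟨a, ha, rfl, j, hj, hji, rfl⟩
      · rintro rfl
        exact hxT hy
      · exact fun h => hji (((hv.sameType a ha).isIncreasing ho).1.injective h)
    have hyx' : y ≠ x' := by rintro rfl; exact hx'X hyX
    have h1 : y < x' ↔ y < x := by rw [hx'L y hyX, Set.mem_ofPred_eq, hyx.le_iff_lt]
    refine pairType_eq_iff.2 ⟨hx'R y hy, ?_, h1⟩
    rw [← not_iff_not, not_lt, not_lt, hyx.le_iff_lt, hyx'.le_iff_lt, h1]
  have hupd : ∀ a ∈ v.support, a i = x → SameType c S o (Function.update a i x') := by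
    intro a ha hax
    have hs := hv.sameType a ha
    refine hG.sameType_update hs ?_ (fun j hj => ?_) fun s hs' => ?_
    · rw [hx'x', ← hax]
      exact (pairType_eq_iff.1 (hs.1 i i)).1
    · rw [← hs.1 i j, hax]
      refine hpt _ ?_
      by_cases hjI : j ∈ I
      · exact .inr ⟨a, ha, hax, j, hjI, hj, rfl⟩
      · exact .inl (.inr ⟨j, hjI, (hv.agree a ha j hjI).symm⟩)
    · rw [← hs.2 i s hs', hax]
      exact hpt _ (.inl (.inl hs'))
  have hxx' : x ≠ x' := (hVX _ hxV).symm
  set w := v.filter fun a => a i = x with hw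
  set v' := v - (w - upd F i x' w) with hv'
  have hv'2 : v' = v.filter (fun a => ¬ a i = x) + upd F i x' w := by
    rw [hv', sub_sub_eq_add_sub, add_sub_right_comm]
    congr 1
    rw [sub_eq_iff_eq_add', hw, Finsupp.filter_add_filter_not]
  have hsupp : ∀ a ∈ v'.support, (a ∈ v.support ∧ a i ≠ x) ∨
      ∃ a' ∈ v.support, a' i = x ∧ a = Function.update a' i x' := by
    intro a ha
    rw [hv'2] at ha
    rcases Finset.mem_union.1 (Finsupp.support_add ha) with h | h
    · left
      simpa [Finsupp.support_filter] using h
    · right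
      obtain ⟨a', ha', rfl⟩ := Finset.mem_image.1 (Finsupp.mapDomain_support h)
      rw [hw, Finsupp.support_filter, Finset.mem_filter] at ha'
      exact ⟨a', ha'.1, ha'.2, rfl⟩
  have hvert : ∀ p ∈ vertices I v', p ≠ (i, x) ∧ (p ∈ vertices I v ∨ p = (i, x')) := by
    rintro ⟨j, y⟩ hp
    obtain ⟨a, ha, hjI, h⟩ := mem_vertices.1 hp
    obtain rfl : a j = y := h
    rcases hsupp a ha with ⟨hav, hax⟩ | ⟨a', ha', hax, rfl⟩
    · refine ⟨?_, .inl (mem_vertices.2 ⟨a, hav, hjI, rfl⟩)⟩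
      rintro h
      obtain ⟨rfl, h'⟩ := Prod.mk.inj h
      exact hax h'
    · rcases eq_or_ne j i with rfl | hj
      · refine ⟨?_, .inr (by simp)⟩
        simpa using hxx'.symm
      · exact ⟨by simp [hj], .inl (mem_vertices.2 ⟨a', ha', hjI, by simp [hj]⟩)⟩
  set P' := (insert (i, x') P) ∩ vertices I v' with hP'
  refine ⟨v', P', ⟨?_, ?_, ?_⟩, ⟨Finset.inter_subset_right, ?_, ?_⟩, ?_, ?_⟩
  · intro a ha
    rcases hsupp a ha with ⟨hav, -⟩ | ⟨a', ha', hax, rfl⟩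
    · exact hv.sameType a hav
    · exact hupd a' ha' hax
  · intro a ha j hj
    rcases hsupp a ha with ⟨hav, -⟩ | ⟨a', ha', hax, rfl⟩
    · exact hv.agree a hav j hj
    · have : j ≠ i := by rintro rfl; contradiction
      rw [Function.update_of_ne this]
      exact hv.agree a' ha' j hj
  · intro j hj y
    rw [hv', map_sub, hv.killed j hj, map_sub]
    rcases eq_or_ne j i with rfl | hji
    · simp
    · rw [upd_comm hji, hw, upd_filter hji.symm, hv.killed j hj, Finsupp.filter_zero]
      simp
  · rintro p hp r hr hpr
    obtain ⟨hp1, hp2⟩ := Finset.mem_inter.1 hp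
    rcases Finset.mem_insert.1 hp1 with rfl | hpP
    · rcases (hvert r hr).2 with h | rfl
      · exact hVX r h
      · exact absurd rfl hpr
    · rcases (hvert r hr).2 with h | rfl
      · exact hP.ne p hpP r h hpr
      · exact (hVX p (hP.subset hpP)).symm
  -- A clean vertex related to `x'` must lie in `N`, hence shares a tuple with `x`. Its coordinate
  -- is then forced, and the relation is the one prescribed by `o`.
  · have key : ∀ p ∈ P, ¬ unrel x' p.2 → p.1 ≠ i ∧ c x' p.2 = c (o i) (o p.1) := by
      intro p hp hu
      have hpV := hP.subset hp
      have hR : p.2 ∈ T ∪ N := by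
        by_contra h
        exact hu (hx'u p.2 (.inr ⟨p, hpV, rfl⟩) h)
      obtain ⟨b, hb, hpI, hbp⟩ := mem_vertices.1 hpV
      rcases id hR with h | ⟨a, ha, hax, j, hj, hji, haj⟩
      · exact absurd h (hbp ▸ hv.notMem_base ho hb hpI)
      · have : p = (j, p.2) := by
          by_contra hne
          exact hP.ne p hp (j, p.2) (mem_vertices.2 ⟨a, ha, hj, haj⟩) hne rfl
        have hpj : p.1 = j := congrArg Prod.fst this
        refine ⟨hpj ▸ hji, ?_⟩
        rw [hx'R _ hR, id, hpj, ← haj, ← hax]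
        exact (pairType_eq_iff.1 ((hv.sameType a ha).1 i j)).1
    rintro p hp r hr hpr hu
    obtain ⟨hp1, hp2⟩ := Finset.mem_inter.1 hp
    obtain ⟨hr1, hr2⟩ := Finset.mem_inter.1 hr
    rcases Finset.mem_insert.1 hp1 with rfl | hpP <;> rcases Finset.mem_insert.1 hr1 with rfl | hrP
    · exact absurd rfl hpr
    · obtain ⟨h1, h2⟩ := key r hrP hu
      exact ⟨h1.symm, h2⟩
    · obtain ⟨h1, h2⟩ := key p hpP fun h => hu (hG.unrel_symm h)
      exact ⟨h1, hG.c_symm h2⟩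
    · exact hP.related p hpP r hrP hpr hu
  · refine Finset.card_lt_card ⟨fun p hp => ?_, fun h => ?_⟩
    · obtain ⟨hp1, hp2⟩ := Finset.mem_sdiff.1 hp
      have hp3 : p ∉ insert (i, x') P := fun h => hp2 (Finset.mem_inter.2 ⟨h, hp1⟩)
      rw [Finset.mem_insert, not_or] at hp3
      exact Finset.mem_sdiff.2 ⟨(hvert p hp1).2.resolve_right hp3.1, hp3.2⟩
    · exact (hvert _ (Finset.mem_sdiff.1 (h hx)).1).1 rfl
  · rw [hv', sub_sub_cancel]
    exact hv.replace hG hi hS ho (ih i hi) hxx' hupd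

/-- Cycles are linear combinations of cogs. -/
theorem IsCycle.mem_cogSpan (hG : IsPairGeneric c unrel G) [Finite ι] (n : ℕ) (I : Finset ι)
    (hn : I.card = n) (S : Set A) (o : ι → A) (v : (ι → A) →₀ F) (hS : S.Finite)
    (ho : IsIncreasing S o) (hv : IsCycle F c S I o v) : v ∈ cogSpan F c S I o := by
  induction n generalizing I S o v with
  | zero =>
    obtain rfl := Finset.card_eq_zero.1 hn
    have : v = v o • cog F ∅ o o := by
      ext a
      by_cases ha : a ∈ v.support
      · obtain rfl : a = o := funext fun j => hv.agree a ha j (by simp)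
        simp [cog]
      · have : a ≠ o ∨ v o = 0 := by
          by_contra! h
          exact h.2 (by simpa [h.1] using ha)
        rw [Finsupp.notMem_support_iff.1 ha]
        rcases this with h | h
        · simp [cog, h.symm]
        · simp [h]
    rw [this]
    exact Submodule.smul_mem _ _ (Submodule.subset_span
      ⟨o, o, (SameType.refl S o).isCog, fun j _ => ⟨rfl, rfl⟩, rfl⟩)
  | succ n ihn =>
    have ih : ∀ i ∈ I, ∀ (S' : Set A) (o' : ι → A) (w : (ι → A) →₀ F), S'.Finite →
        IsIncreasing S' o' → IsCycle F c S' (I.erase i) o' w →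
        w ∈ cogSpan F c S' (I.erase i) o' := fun i hi S' o' w hS' ho' hw =>
      ihn _ (by rw [Finset.card_erase_of_mem hi, hn]; rfl) S' o' w hS' ho' hw
    -- Inner induction on the number of vertices not yet clean, for a fixed coordinate set.
    have main : ∀ (m : ℕ) (v : (ι → A) →₀ F) (P : Finset (ι × A)), IsCycle F c S I o v →
        IsClean c unrel o I v P → (vertices I v \ P).card = m → v ∈ cogSpan F c S I o := by
      intro m
      induction m using Nat.strong_induction_on with
      | _ m ihm =>
        intro v P hv hP hm
        rcases (vertices I v \ P).eq_empty_or_nonempty with h | ⟨⟨i, x⟩, hx⟩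
        · obtain rfl : P = vertices I v :=
            hP.subset.antisymm (Finset.sdiff_eq_empty_iff_subset.1 h)
          exact hv.mem_cogSpan_of_clean hG (Finset.card_pos.1 (by omega)) hS inferInstance ho ih hP
        · obtain ⟨v', P', hv', hP', hlt, hd⟩ := hv.exists_cleaner hG hS inferInstance ho ih hP hx
          have := ihm _ (hm ▸ hlt) v' P' hv' hP' rfl
          simpa using Submodule.add_mem _ hd this
    exact main _ v ∅ hv ⟨by simp, by simp, by simp⟩ rfl

end Generation

section Action

variable {A ι F : Type*}

variable (F) [Field F]

/-- The linear action of a permutation on formal combinations of tuples. -/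
noncomputable def act (g : A → A) : ((ι → A) →₀ F) →ₗ[F] ((ι → A) →₀ F) :=
  Finsupp.lmapDomain F F fun a => g ∘ a

variable {F}

@[simp]
theorem act_single (g : A → A) (a : ι → A) (r : F) :
    act F g (Finsupp.single a r) = Finsupp.single (g ∘ a) r := by
  simp [act]

theorem act_cog [DecidableEq ι] (g : A → A) (I : Finset ι) (a b : ι → A) :
    act F g (cog F I a b) = cog F I (g ∘ a) (g ∘ b) := by
  rw [cog, cog, map_sum]
  refine Finset.sum_congr rfl fun e _ => ?_
  rw [map_smul, act_single]
  congr 2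
  ext j
  by_cases hj : j ∈ e <;> simp [hj]

end Action

/-! ### Simplicity: free cogs in invariant subspaces -/

section Simple

variable {A τ ι F : Type*} [LinearOrder A] {c : A → A → τ} {unrel : A → A → Prop}
  {G : Subgroup (Equiv.Perm A)} {S : Set A} {o a b a' b' : ι → A}

/-- The copy is placed just above `m`. By `hRm` no point of `R` separates `a₀` from `m`, so it still
has the order type of `a₀` over `R`, while points outside `R` are left unrelated to it. -/
theorem IsPairGeneric.exists_copy (hG : IsPairGeneric c unrel G) {X R : Set A} {a₀ m : A}
    (hX : X.Finite) (hR : R ⊆ X) (ham : a₀ ≤ m) (hRm : ∀ y ∈ R, (y ≤ m ↔ y < a₀)) :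
    ∃ x ∉ X, c x x = c a₀ a₀ ∧ (∀ y ∈ R, pairType c x y = pairType c a₀ y) ∧
      (∀ y ∈ X, y ∉ R → unrel x y) ∧ ∀ y ∈ X, y ≤ m → y < x := by
  obtain ⟨x, hxX, hxx, hxR, hxu, hxL⟩ := hG.ext X R {y | y ≤ m} id a₀ hX hR
    (fun y _ z _ hzy hy => hzy.le.trans hy) (fun _ _ => rfl) (fun _ _ _ _ _ => rfl)
  refine ⟨x, hxX, hxx, fun y hy => ?_, hxu, fun y hy => (hxL y hy).2⟩
  have hyx : y ≠ x := by rintro rfl; exact hxX (hR hy)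
  have hya : y ≠ a₀ := by rintro rfl; exact lt_irrefl _ ((hRm y hy).1 ham)
  have h1 : y < x ↔ y < a₀ := (hxL y (hR hy)).trans (hRm y hy)
  refine pairType_eq_iff.2 ⟨hxR y hy, ?_, h1⟩
  rw [← not_iff_not, not_lt, not_lt, hyx.le_iff_lt, hya.le_iff_lt, h1]

theorem IsCog.update_right [DecidableEq ι] (hG : IsPairGeneric c unrel G) (h : IsCog c S o a b)
    {i : ι} {x : A} (hx : c x x = c (o i) (o i))
    (hxS : ∀ s ∈ S, pairType c x s = pairType c (o i) s)
    (hxj : ∀ j y, j ≠ i → y = a j ∨ y = b j → pairType c x y = pairType c (o i) (o j)) :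
    IsCog c S o a (Function.update b i x) := by
  intro j y hy
  by_cases hjy : j = i ∧ y = x
  · obtain ⟨rfl, rfl⟩ := hjy
    exact ⟨hG.pairType_self hx, hxS, fun k z hk hz => hxj k z hk (by simpa [hk] using hz)⟩
  · have hy' : y = a j ∨ y = b j := by
      rcases eq_or_ne j i with rfl | hj
      · simp only [Function.update_self] at hy
        tauto
      · simpa [hj] using hy
    obtain ⟨e1, e2, e3⟩ := h j y hy'
    refine ⟨e1, e2, fun k z hk hz => ?_⟩
    by_cases hkz : k = i ∧ z = x
    · obtain ⟨rfl, rfl⟩ := hkz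
      exact hG.pairType_symm (hxj j y hk.symm hy')
    · refine e3 k z hk ?_
      rcases eq_or_ne k i with rfl | hk'
      · simp only [Function.update_self] at hz
        tauto
      · simpa [hk'] using hz

theorem IsCog.update_left [DecidableEq ι] (h : IsCog c S o a b) (i : ι) :
    IsCog c S o (Function.update a i (b i)) b := by
  have : ∀ j y, y = Function.update a i (b i) j ∨ y = b j → y = a j ∨ y = b j := by
    intro j y hy
    rcases eq_or_ne j i with rfl | hj
    · simp only [Function.update_self] at hy
      tauto
    · simpa [hj] using hy
  intro j y hy
  obtain ⟨e1, e2, e3⟩ := h j y (this j y hy)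
  exact ⟨e1, e2, fun k z hk hz => e3 k z hk (this k z hz)⟩

/-- The cog condition fixes all pair types between different coordinates, and being unrelated and
ordered fixes those within a pair. Homogeneity then moves both tuples at once. -/
theorem IsCog.exists_map (hG : IsPairGeneric c unrel G) [Finite ι] (hS : S.Finite)
    (h : IsCog c S o a b) (h' : IsCog c S o a' b') (hs : ∀ j, unrel (a j) (b j) ∧ a j < b j)
    (hs' : ∀ j, unrel (a' j) (b' j) ∧ a' j < b' j) :
    ∃ g ∈ G, (∀ s ∈ S, g s = s) ∧ ⇑g ∘ a = a' ∧ ⇑g ∘ b = b' := by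
  have hdiag : ∀ j, pairType c (a' j) (b' j) = pairType c (a j) (b j) := fun j =>
    pairType_eq_iff.2 ⟨hG.c_of_unrel (hs' j).1 (hs j).1
      (pairType_eq_iff.1 ((h' j _ (.inl rfl)).1.trans (h j _ (.inl rfl)).1.symm)).1
      (pairType_eq_iff.1 ((h' j _ (.inr rfl)).1.trans (h j _ (.inr rfl)).1.symm)).1,
      iff_of_true (hs' j).2 (hs j).2, iff_of_false (hs' j).2.not_gt (hs j).2.not_gt⟩
  obtain ⟨g, hg, hgS, hgi⟩ := hG.exists_map (S := S) (o := Sum.elim a b) (a := Sum.elim a' b') hS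
    ⟨by
      rintro (j | j) (k | k) <;> rcases eq_or_ne k j with rfl | hk <;>
        simp only [Sum.elim_inl, Sum.elim_inr]
      · exact (h' k _ (.inl rfl)).1.trans (h k _ (.inl rfl)).1.symm
      · exact ((h' j _ (.inl rfl)).2.2 k _ hk (.inl rfl)).trans
          ((h j _ (.inl rfl)).2.2 k _ hk (.inl rfl)).symm
      · exact hdiag k
      · exact ((h' j _ (.inl rfl)).2.2 k _ hk (.inr rfl)).trans
          ((h j _ (.inl rfl)).2.2 k _ hk (.inr rfl)).symm
      · exact hG.pairType_symm (hdiag k)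
      · exact ((h' j _ (.inr rfl)).2.2 k _ hk (.inl rfl)).trans
          ((h j _ (.inr rfl)).2.2 k _ hk (.inl rfl)).symm
      · exact (h' k _ (.inr rfl)).1.trans (h k _ (.inr rfl)).1.symm
      · exact ((h' j _ (.inr rfl)).2.2 k _ hk (.inr rfl)).trans
          ((h j _ (.inr rfl)).2.2 k _ hk (.inr rfl)).symm, by
      rintro (j | j) s hs
      · exact ((h' j _ (.inl rfl)).2.1 s hs).trans ((h j _ (.inl rfl)).2.1 s hs).symm
      · exact ((h' j _ (.inr rfl)).2.1 s hs).trans ((h j _ (.inr rfl)).2.1 s hs).symm⟩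
  exact ⟨g, hg, hgS, funext fun j => hgi (.inl j), funext fun j => hgi (.inr j)⟩

variable [Field F]

/-- The subspaces that are invariant under the elements of `G` that fix `S` pointwise. -/
def IsInvariant (G : Subgroup (Equiv.Perm A)) (S : Set A) (W : Submodule F ((ι → A) →₀ F)) : Prop :=
  ∀ g ∈ G, (∀ s ∈ S, g s = s) → ∀ v ∈ W, act F g v ∈ W

variable [LinearOrder ι] [Fintype ι]

/-- A combination of increasing tuples of the same type generates a cog on free pairs. -/
theorem exists_cog_mem (hG : IsPairGeneric c unrel G) (hS : S.Finite) (ho : IsIncreasing S o)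
    {W : Submodule F ((ι → A) →₀ F)} (hW : IsInvariant G S W) {w : (ι → A) →₀ F} (hw : w ∈ W)
    (hwo : ∀ a ∈ w.support, SameType c S o a) (ha : a ∈ w.support) :
    ∃ b, IsCog c S o a b ∧ (∀ j, unrel (a j) (b j) ∧ a j < b j) ∧
      cog F Finset.univ a b ∈ W := by
  have hainc := (hwo a ha).isIncreasing ho
  -- The coordinates in `J` have been treated. Every tuple of the remainder `r` omits some `a j`
  -- with `j ∉ J`, so nothing remains when `J` is everything.
  have main : ∀ J : Finset ι, ∃ (b : ι → A) (r : (ι → A) →₀ F), IsCog c S o a b ∧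
      (∀ j ∉ J, b j = a j) ∧ (∀ j ∈ J, unrel (a j) (b j) ∧ a j < b j) ∧
      w a • cog F J a b + r ∈ W ∧ ∀ t ∈ r.support, ∃ j ∉ J, ∀ k, t k ≠ a j := by
    intro J
    induction J using Finset.induction_on with
    | empty =>
      refine ⟨a, w - Finsupp.single a (w a), (hwo a ha).isCog, fun _ _ => rfl, by simp, ?_, ?_⟩
      · simpa [cog] using hw
      · intro t ht
        have hta : t ≠ a := by
          rintro rfl
          simp at ht
        have htw : t ∈ w.support := by
          simpa [Finsupp.single_apply, hta.symm] using ht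
        by_contra! h
        -- A strictly increasing tuple is determined by its range, so a tuple other than `a` omits
        -- some entry of `a`.
        refine hta (StrictMono.range_inj ((hwo t htw).isIncreasing ho).1 hainc.1 |>.1 ?_)
        refine (Set.eq_of_subset_of_ncard_le ?_ ?_ (Set.finite_range t)).symm
        · rintro _ ⟨j, rfl⟩
          obtain ⟨k, hk⟩ := h j (by simp)
          exact ⟨k, hk⟩
        · rw [← Set.image_univ, ← Set.image_univ,
            Set.ncard_image_of_injective _ ((hwo t htw).isIncreasing ho).1.injective,
            Set.ncard_image_of_injective _ hainc.1.injective]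
    | insert i J hiJ ih =>
      obtain ⟨b, r, hb, hboff, hbJ, hmem, hr⟩ := ih
      set X : Set A := S ∪ Set.range a ∪ Set.range b ∪ ⋃ t ∈ r.support, Set.range t with hX
      have hXfin : X.Finite := ((hS.union (Set.finite_range _)).union (Set.finite_range _)).union
        (Set.Finite.biUnion r.support.finite_toSet fun t _ => Set.finite_range t)
      have hSX : S ⊆ X := fun s hs => .inl (.inl (.inl hs))
      have haX : ∀ j, a j ∈ X := fun j => .inl (.inl (.inr ⟨j, rfl⟩))
      have hbX : ∀ j, b j ∈ X := fun j => .inl (.inr ⟨j, rfl⟩)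
      have htX : ∀ t ∈ r.support, ∀ k, t k ∈ X := fun t ht k =>
        .inr (Set.mem_biUnion ht ⟨k, rfl⟩)
      obtain ⟨x, hxX, hxx, hxp, hxu, hxl⟩ := hG.exists_copy (R := X \ {a i}) (a₀ := a i) (m := a i)
        hXfin Set.sdiff_subset le_rfl fun y hy => (show y ≠ a i from hy.2).le_iff_lt
      -- `g` moves `a i` to its copy `x` and fixes all other points in sight. Subtracting the image
      -- under `g` creates the factor `a i - x` and cancels the tuples that avoid `a i`.
      obtain ⟨g, hg, hgX, hgx⟩ := hG.exists_map (ι := Unit) (S := X \ {a i}) (o := fun _ => a i)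
        (a := fun _ => x) hXfin.sdiff ⟨fun _ _ => hG.pairType_self hxx, fun _ => hxp⟩
      replace hgx := hgx ()
      have hai : ∀ j, j ≠ i → a j ≠ a i := fun j hj h => hj (hainc.1.injective h)
      have hbi : ∀ j, j ≠ i → b j ≠ a i := fun j hj h => hj
        (ho.1.injective ((pairType_eq ((hb j _ (.inr rfl)).2.2 i _ hj.symm (.inl rfl))).1 h))
      have hSi : ∀ s ∈ S, s ≠ a i := by
        rintro s hs rfl
        exact hainc.2 i hs
      have hga : ⇑g ∘ a = Function.update a i x := by
        ext j
        rcases eq_or_ne j i with rfl | hj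
        · simp [hgx]
        · simpa [hj] using hgX _ ⟨haX j, hai j hj⟩
      have hgb : ⇑g ∘ b = Function.update b i x := by
        ext j
        rcases eq_or_ne j i with rfl | hj
        · simp [hgx, hboff j hiJ]
        · simpa [hj] using hgX _ ⟨hbX j, hbi j hj⟩
      refine ⟨Function.update b i x, r - act F g r, ?_, ?_, ?_, ?_, ?_⟩
      · refine hb.update_right hG ?_ (fun s hs => ?_) fun j y hj hy => ?_
        · rw [hxx]
          exact (pairType_eq_iff.1 (hb i _ (.inl rfl)).1).1
        · rw [hxp s ⟨hSX hs, hSi s hs⟩]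
          exact (hb i _ (.inl rfl)).2.1 s hs
        · rw [← (hb i _ (.inl rfl)).2.2 j y hj hy]
          apply hxp
          rcases hy with rfl | rfl
          · exact ⟨haX j, hai j hj⟩
          · exact ⟨hbX j, hbi j hj⟩
      · intro j hj
        rw [Finset.mem_insert, not_or] at hj
        rw [Function.update_of_ne hj.1, hboff j hj.2]
      · intro j hj
        rcases eq_or_ne j i with rfl | hji
        · rw [Function.update_self]
          exact ⟨hG.unrel_symm (hxu _ (haX j) (by simp)), hxl _ (haX j) le_rfl⟩
        · rw [Function.update_of_ne hji]
          exact hbJ j ((Finset.mem_insert.1 hj).resolve_left hji)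
      · have h1 := W.sub_mem hmem (hW g hg (fun s hs => hgX s ⟨hSX hs, hSi s hs⟩) _ hmem)
        rw [map_add, map_smul, act_cog, hga, hgb, cog_update_right hiJ, cog_update_left hiJ] at h1
        rw [cog_insert hiJ, cog_update_right hiJ, Function.update_self, smul_sub]
        convert h1 using 1
        abel
      · set Q : Set (ι → A) := {t | ∃ j ∉ insert i J, ∀ k, t k ≠ a j} with hQ
        have hmemQ : r - act F g r ∈ Finsupp.supported F F Q := by
          have : r - act F g r = r.sum fun t s =>
              (Finsupp.single t s - Finsupp.single (⇑g ∘ t) s) := by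
            conv_lhs => rw [← Finsupp.sum_single r]
            rw [Finsupp.sum, Finsupp.sum, map_sum, ← Finset.sum_sub_distrib]
            simp
          rw [this]
          refine Submodule.sum_mem _ fun t ht => ?_
          -- A remainder tuple containing `a i` omits an `a j` with `j ≠ i`, and so does its image
          -- since `x` is new. A tuple without `a i` is fixed by `g` and cancels.
          by_cases hti : ∃ k, t k = a i
          · obtain ⟨k₀, hk₀⟩ := hti
            obtain ⟨j, hj, hjt⟩ := hr t ht
            have hji : j ≠ i := by
              rintro rfl
              exact hjt k₀ hk₀
            have hj' : j ∉ insert i J := by simp [hji, hj]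
            refine Submodule.sub_mem _ (Finsupp.single_mem_supported F _ ⟨j, hj', hjt⟩)
              (Finsupp.single_mem_supported F _ ⟨j, hj', fun k => ?_⟩)
            by_cases hk : t k = a i
            · rw [Function.comp_apply, hk, hgx]
              rintro rfl
              exact hxX (haX j)
            · rw [Function.comp_apply, hgX _ ⟨htX t ht k, hk⟩]
              exact hjt k
          · have : ⇑g ∘ t = t := by
              ext k
              exact hgX _ ⟨htX t ht k, fun h => hti ⟨k, h⟩⟩
            simp [this]
        exact fun t ht => hmemQ ht
  obtain ⟨b, r, hb, -, hbJ, hmem, hr⟩ := main Finset.univ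
  have hr0 : r = 0 := by
    by_contra h
    obtain ⟨t, ht⟩ := Finsupp.support_nonempty_iff.2 h
    obtain ⟨j, hj, -⟩ := hr t ht
    exact hj (Finset.mem_univ j)
  refine ⟨b, hb, fun j => hbJ j (Finset.mem_univ j), ?_⟩
  rw [hr0, add_zero] at hmem
  exact (W.smul_mem_iff (Finsupp.mem_support_iff.1 ha)).1 hmem

/-- Every cog is a combination of cogs on free pairs. -/
theorem cog_mem_of_free (hG : IsPairGeneric c unrel G) (hS : S.Finite) (ho : IsIncreasing S o)
    {W : Submodule F ((ι → A) →₀ F)}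
    (hW : ∀ a b, IsCog c S o a b → (∀ j, unrel (a j) (b j) ∧ a j < b j) →
      cog F Finset.univ a b ∈ W) (J : Finset ι) (a b : ι → A) (h : IsCog c S o a b)
    (hJ : ∀ j ∉ J, unrel (a j) (b j) ∧ a j < b j) : cog F Finset.univ a b ∈ W := by
  induction J using Finset.induction_on generalizing a b with
  | empty => exact hW a b h fun j => hJ j (by simp)
  | insert i J hiJ ih =>
    set R : Set A := S ∪ (a '' {j | j ≠ i} ∪ b '' {j | j ≠ i}) with hR
    have hRo : ∀ z, z = a i ∨ z = b i → ∀ y ∈ R, pairType c z y = pairType c (a i) y := by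
      rintro z hz y (hy | ⟨j, hj, rfl⟩ | ⟨j, hj, rfl⟩)
      · rw [(h i z hz).2.1 y hy, (h i _ (.inl rfl)).2.1 y hy]
      · rw [(h i z hz).2.2 j _ hj (.inl rfl), (h i _ (.inl rfl)).2.2 j _ hj (.inl rfl)]
      · rw [(h i z hz).2.2 j _ hj (.inr rfl), (h i _ (.inl rfl)).2.2 j _ hj (.inr rfl)]
    have hRne : a i ∉ R := by
      rintro (hy | ⟨j, hj, hy⟩ | ⟨j, hj, hy⟩)
      · have := (pairType_eq ((h i _ (.inl rfl)).2.1 _ hy)).1 rfl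
        exact ho.2 i (this ▸ hy)
      · exact hj (ho.1.injective
          ((pairType_eq ((h j _ (.inl rfl)).2.2 i _ (Ne.symm hj) (.inl rfl))).1 hy))
      · exact hj (ho.1.injective
          ((pairType_eq ((h j _ (.inr rfl)).2.2 i _ (Ne.symm hj) (.inl rfl))).1 hy))
    -- `x` lies above both `a i` and `b i` and is unrelated to both, so either of them forms a free
    -- pair with `x`. The split `a i - b i = (a i - x) - (b i - x)` then frees coordinate `i`.
    obtain ⟨x, hxX, hxx, hxp, hxu, hxl⟩ := hG.exists_copy (X := R ∪ {a i, b i}) (R := R)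
      (a₀ := a i) (m := max (a i) (b i))
      ((hS.union ((Set.toFinite _).union (Set.toFinite _))).union (Set.toFinite _))
      Set.subset_union_left (le_max_left _ _) fun y hy => by
        have h1 : y ≠ a i := by rintro rfl; exact hRne hy
        have h2 : y ≠ b i := fun hb => h1 ((pairType_eq (hRo _ (.inr rfl) y hy)).1 hb.symm).symm
        have h3 := (pairType_eq_iff.1 (hRo _ (.inr rfl) y hy)).2.2
        rw [le_max_iff, h1.le_iff_lt, h2.le_iff_lt, h3, or_self]
    have hbR : b i ∉ R := fun hb => hRne
      (by rwa [← (pairType_eq (hRo _ (.inr rfl) _ hb)).1 rfl] at hb)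
    have h2 : IsCog c S o a (Function.update b i x) := by
      refine h.update_right hG ?_ (fun s hs => ?_) fun j y hj hy => ?_
      · rw [hxx]
        exact (pairType_eq_iff.1 (h i _ (.inl rfl)).1).1
      · rw [hxp s (.inl hs)]
        exact (h i _ (.inl rfl)).2.1 s hs
      · rw [← (h i _ (.inl rfl)).2.2 j y hj hy]
        apply hxp
        rcases hy with rfl | rfl
        · exact .inr (.inl ⟨j, hj, rfl⟩)
        · exact .inr (.inr ⟨j, hj, rfl⟩)
    have h3 : IsCog c S o (Function.update a i (b i)) (Function.update b i x) := by
      refine (h.update_left i).update_right hG ?_ (fun s hs => ?_) fun j y hj hy => ?_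
      · rw [hxx]
        exact (pairType_eq_iff.1 (h i _ (.inl rfl)).1).1
      · rw [hxp s (.inl hs)]
        exact (h i _ (.inl rfl)).2.1 s hs
      · rw [Function.update_of_ne hj] at hy
        rw [← (h i _ (.inl rfl)).2.2 j y hj hy]
        apply hxp
        rcases hy with rfl | rfl
        · exact .inr (.inl ⟨j, hj, rfl⟩)
        · exact .inr (.inr ⟨j, hj, rfl⟩)
    rw [cog_split (Finset.mem_univ i) a b x]
    refine W.sub_mem (ih _ _ h2 fun j hj => ?_) (ih _ _ h3 fun j hj => ?_)
    · rcases eq_or_ne j i with rfl | hji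
      · rw [Function.update_self]
        exact ⟨hG.unrel_symm (hxu _ (by simp) hRne), hxl _ (by simp) (le_max_left _ _)⟩
      · rw [Function.update_of_ne hji]
        exact hJ j (by simp [hj, hji])
    · rcases eq_or_ne j i with rfl | hji
      · rw [Function.update_self, Function.update_self]
        exact ⟨hG.unrel_symm (hxu _ (by simp) hbR), hxl _ (by simp) (le_max_right _ _)⟩
      · rw [Function.update_of_ne hji, Function.update_of_ne hji]
        exact hJ j (by simp [hj, hji])

/-- The space of cycles is a simple representation. -/
theorem IsCycle.mem_of_invariant (hG : IsPairGeneric c unrel G) (hS : S.Finite)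
    (ho : IsIncreasing S o) {W : Submodule F ((ι → A) →₀ F)} (hW : IsInvariant G S W)
    {w w' : (ι → A) →₀ F} (hw : w ∈ W) (hw0 : w ≠ 0) (hwc : ∀ a ∈ w.support, SameType c S o a)
    (hwc' : IsCycle F c S Finset.univ o w') : w' ∈ W := by
  obtain ⟨a, ha⟩ := Finsupp.support_nonempty_iff.2 hw0
  obtain ⟨b, hab, hfree, hmem⟩ := exists_cog_mem hG hS ho hW hw hwc ha
  refine (Submodule.span_le.2 ?_ : cogSpan F c S Finset.univ o ≤ W)
    (hwc'.mem_cogSpan hG _ _ rfl S o w' hS ho)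
  rintro _ ⟨a', b', hab', -, rfl⟩
  refine cog_mem_of_free hG hS ho (fun a'' b'' h'' hf'' => ?_) Finset.univ a' b' hab' (by simp)
  obtain ⟨g, hg, hgS, rfl, rfl⟩ := hab.exists_map hG hS h'' hfree hf''
  rw [← act_cog]
  exact hW g hg hgS _ hmem

end Simple

/-! ### Colours of pairs in a binary vocabulary -/

section Colours

variable {L₀ : FirstOrder.Language.{u, v}} {M N : Type*} [L₀.Structure M] [L₀.Structure N]

variable (L₀) in
/-- The relational type of a pair of points, up to relations within a single point. -/
def colour (x y : M) : (L₀.Relations 1 → Prop) × (L₀.Relations 1 → Prop) ×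
    (L₀.Relations 2 → Prop) × (L₀.Relations 2 → Prop) :=
  (fun R => Structure.RelMap R ![x], fun R => Structure.RelMap R ![y],
    fun R => Structure.RelMap R ![x, y], fun R => Structure.RelMap R ![y, x])

variable (L₀) in
/-- No binary relation holds between the two points. -/
def Unrelated (x y : M) : Prop :=
  ∀ R : L₀.Relations 2, ¬ Structure.RelMap R ![x, y] ∧ ¬ Structure.RelMap R ![y, x]

theorem colour_eq_iff {x y : M} {x' y' : N} : colour L₀ x y = colour L₀ x' y' ↔
    (∀ R : L₀.Relations 1, Structure.RelMap R ![x] ↔ Structure.RelMap R ![x']) ∧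
    (∀ R : L₀.Relations 1, Structure.RelMap R ![y] ↔ Structure.RelMap R ![y']) ∧
    (∀ R : L₀.Relations 2, Structure.RelMap R ![x, y] ↔ Structure.RelMap R ![x', y']) ∧
    (∀ R : L₀.Relations 2, Structure.RelMap R ![y, x] ↔ Structure.RelMap R ![y', x']) := by
  simp [colour, funext_iff]

theorem colour_symm {x y : M} {x' y' : N} (h : colour L₀ x y = colour L₀ x' y') :
    colour L₀ y x = colour L₀ y' x' := by
  rw [colour_eq_iff] at *
  tauto

theorem Unrelated.congr {x y : M} {x' y' : N} (h : colour L₀ x y = colour L₀ x' y')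
    (hu : Unrelated L₀ x y) : Unrelated L₀ x' y' := fun R => by
  rw [colour_eq_iff] at h
  rw [← h.2.2.1 R, ← h.2.2.2 R]
  exact hu R

theorem Unrelated.symm {x y : M} (h : Unrelated L₀ x y) : Unrelated L₀ y x := fun R => (h R).symm

theorem colour_eq_of_unrelated {x y : M} {x' y' : N} (h : Unrelated L₀ x y)
    (h' : Unrelated L₀ x' y') (hx : colour L₀ x x = colour L₀ x' x')
    (hy : colour L₀ y y = colour L₀ y' y') : colour L₀ x y = colour L₀ x' y' := by
  rw [colour_eq_iff] at *
  exact ⟨hx.1, hy.1, fun R => iff_of_false (h R).1 (h' R).1,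
    fun R => iff_of_false (h R).2 (h' R).2⟩

/-- The colour of a pair of distinct points does not record loops. Irreflexivity on both sides makes
the missing information trivial. -/
theorem colour_self_eq (hM : ∀ x : M, Unrelated L₀ x x) (hN : ∀ x : N, Unrelated L₀ x x)
    {x y : M} {x' y' : N} (h : colour L₀ x y = colour L₀ x' y') :
    colour L₀ x x = colour L₀ x' x' := by
  rw [colour_eq_iff] at *
  exact ⟨h.1, h.1, fun R => iff_of_false (hM x R).1 (hN x' R).1,
    fun R => iff_of_false (hM x R).1 (hN x' R).1⟩

theorem colour_embedding (e : M ↪[L₀] N) (x y : M) : colour L₀ (e x) (e y) = colour L₀ x y := by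
  have h1 : ∀ x, ![e x] = e ∘ ![x] := fun x => by ext i; fin_cases i; rfl
  have h2 : ∀ x y, ![e x, e y] = e ∘ ![x, y] := fun x y => by ext i; fin_cases i <;> rfl
  refine colour_eq_iff.2 ⟨fun R => ?_, fun R => ?_, fun R => ?_, fun R => ?_⟩
  · rw [h1, e.map_rel]
  · rw [h1, e.map_rel]
  · rw [h2, e.map_rel]
  · rw [h2, e.map_rel]

theorem relMap_comp_iff (hL₀ : IsGraphVocabulary L₀) {f : M → N}
    (hf : ∀ x y, colour L₀ (f x) (f y) = colour L₀ x y) {n : ℕ} (R : L₀.Relations n)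
    (x : Fin n → M) : Structure.RelMap R (f ∘ x) ↔ Structure.RelMap R x := by
  rcases hL₀.arity n ⟨R⟩ with rfl | rfl
  · have h1 : x = ![x 0] := by ext i; fin_cases i; rfl
    have h2 : f ∘ x = ![f (x 0)] := by ext i; fin_cases i; rfl
    rw [h2]
    conv_rhs => rw [h1]
    exact (colour_eq_iff.1 (hf (x 0) (x 0))).1 R
  · have h1 : x = ![x 0, x 1] := by ext i; fin_cases i <;> rfl
    have h2 : f ∘ x = ![f (x 0), f (x 1)] := by ext i; fin_cases i <;> rfl
    rw [h2]
    conv_rhs => rw [h1]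
    exact (colour_eq_iff.1 (hf (x 0) (x 1))).2.2.1 R

/-- An injective map preserving the relational types of pairs is an embedding. -/
def embeddingOfColour [L₀.IsRelational] (hL₀ : IsGraphVocabulary L₀) (f : M → N)
    (hi : Function.Injective f) (hf : ∀ x y, colour L₀ (f x) (f y) = colour L₀ x y) :
    M ↪[L₀] N where
  toFun := f
  inj' := hi
  map_fun' := fun {_} g => isEmptyElim g
  map_rel' := fun R x => relMap_comp_iff hL₀ hf R x

/-- In a relational language every set carries a substructure. -/
def setSubstructure (L : FirstOrder.Language.{u, v}) [L.IsRelational] {M : Type*} [L.Structure M]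
    (s : Set M) : L.Substructure M :=
  ⟨s, fun {_} g => isEmptyElim g⟩

end Colours

/-! ### From free amalgamation to one-point extensions -/

section Classes

variable {L₀ : FirstOrder.Language.{u, v}} [L₀.IsRelational]
  {C₀ : Set (CategoryTheory.Bundled.{w} L₀.Structure)}

theorem IsFreeAmalgamationClass.mem_of_embedding (hC₀ : IsFreeAmalgamationClass C₀)
    {M N : Type w} [L₀.Structure M] [L₀.Structure N] [Finite M] (e : M ↪[L₀] N)
    (hN : (⟨N, inferInstance⟩ : CategoryTheory.Bundled.{w} L₀.Structure) ∈ C₀) :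
    (⟨M, inferInstance⟩ : CategoryTheory.Bundled.{w} L₀.Structure) ∈ C₀ :=
  hC₀.hereditary _ hN ⟨Structure.fg_iff_finite.2 inferInstance, ⟨e⟩⟩

/-- A finite structure belongs to a free amalgamation class in a binary vocabulary as soon as its
substructures in which any two points are related do. -/
theorem IsFreeAmalgamationClass.mem_of_cliques (hL₀ : IsGraphVocabulary L₀)
    (hC₀ : IsFreeAmalgamationClass C₀) (n : ℕ) (M : Type w) [L₀.Structure M] [Finite M]
    (hn : Nat.card M = n) (hirr : ∀ x : M, Unrelated L₀ x x)
    (h : ∀ (Q : Type w) [L₀.Structure Q] (_ : Q ↪[L₀] M),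
      (∀ x y : Q, x ≠ y → ¬ Unrelated L₀ x y) →
      (⟨Q, inferInstance⟩ : CategoryTheory.Bundled.{w} L₀.Structure) ∈ C₀) :
    (⟨M, inferInstance⟩ : CategoryTheory.Bundled.{w} L₀.Structure) ∈ C₀ := by
  classical
  induction n using Nat.strong_induction_on generalizing M with
  | _ n ih =>
    by_cases hM : ∀ x y : M, x ≠ y → ¬ Unrelated L₀ x y
    · exact h M (Embedding.refl L₀ M) hM
    push Not at hM
    obtain ⟨x, y, hxy, hu⟩ := hM
    have hsub : ∀ (s : Set M) (z : M), z ∉ s →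
        (⟨setSubstructure L₀ s, inferInstance⟩ : CategoryTheory.Bundled.{w} L₀.Structure) ∈ C₀ := by
      intro s z hz
      have : Finite (setSubstructure L₀ s) := inferInstanceAs (Finite s)
      refine ih (Nat.card s) ?_ (setSubstructure L₀ s) rfl (fun x => ?_)
        fun Q _ e he => h Q ((setSubstructure L₀ s).subtype.comp e) he
      · rw [← hn, Nat.card_coe_set_eq]
        exact Set.ncard_lt_card fun h => hz (h ▸ Set.mem_univ z)
      · exact (hirr (x : M)).congr (colour_embedding (setSubstructure L₀ s).subtype x x)
    let Px := setSubstructure L₀ {m : M | m ≠ x}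
    let Py := setSubstructure L₀ {m : M | m ≠ y}
    let Pxy := setSubstructure L₀ {m : M | m ≠ x ∧ m ≠ y}
    have hx : Pxy ≤ Px := fun m hm => hm.1
    have hy : Pxy ≤ Py := fun m hm => hm.2
    -- For unrelated `x ≠ y`, `M` is itself the free amalgam of `M \ {x}` and `M \ {y}` over `M \
    -- {x, y}`. The map `f` below identifies it with the one provided.
    obtain ⟨Q, NQ, PQ, hQ, hcomm, -, hmeet, hrel⟩ := hC₀.freeAmalgamation
      ⟨Pxy, inferInstance⟩ ⟨Px, inferInstance⟩ ⟨Py, inferInstance⟩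
      (Substructure.inclusion hx) (Substructure.inclusion hy)
      (hsub _ x (fun h => h.1 rfl)) (hsub _ x (fun h => h rfl)) (hsub _ y (fun h => h rfl))
    let f : M → Q := fun m =>
      if hm : m ≠ x then NQ ⟨m, hm⟩ else PQ ⟨m, fun h => hm (h ▸ hxy.symm)⟩
    have hfx : ∀ m (hm : m ≠ x), f m = NQ ⟨m, hm⟩ := fun m hm => by simp only [f, dif_pos hm]
    have hfy : ∀ m (hm : m ≠ y), f m = PQ ⟨m, hm⟩ := fun m hm => by
      by_cases hmx : m = x
      · simp only [f, dif_neg (not_not.2 hmx)]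
      · rw [hfx m hmx]
        exact DFunLike.congr_fun hcomm (⟨m, hmx, hm⟩ : Pxy)
    have hfu : Unrelated L₀ (f x) (f y) := by
      have hxN : f x ∉ Set.range NQ := by
        rintro ⟨p, hp⟩
        rw [hfy x hxy] at hp
        obtain ⟨m, -, hm⟩ := hmeet _ _ hp
        exact m.2.1 (congrArg Subtype.val hm)
      have hyP : f y ∉ Set.range PQ := by
        rintro ⟨p, hp⟩
        rw [hfx y hxy.symm] at hp
        obtain ⟨m, hm, -⟩ := hmeet _ _ hp.symm
        exact m.2.2 (congrArg Subtype.val hm)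
      refine fun R => ⟨fun hR => ?_, fun hR => ?_⟩
      · rcases hrel 2 R _ hR with h' | h'
        · exact hxN (h' 0)
        · exact hyP (h' 1)
      · rcases hrel 2 R _ hR with h' | h'
        · exact hxN (h' 1)
        · exact hyP (h' 0)
    have hself : ∀ m, colour L₀ (f m) (f m) = colour L₀ m m := fun m => by
      by_cases hmx : m = x
      · have hmy : m ≠ y := hmx ▸ hxy
        rw [hfy m hmy, colour_embedding]
        exact (colour_embedding Py.subtype (⟨m, hmy⟩ : Py) (⟨m, hmy⟩ : Py)).symm
      · rw [hfx m hmx, colour_embedding]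
        exact (colour_embedding Px.subtype (⟨m, hmx⟩ : Px) (⟨m, hmx⟩ : Px)).symm
    have hcol : ∀ m m', colour L₀ (f m) (f m') = colour L₀ m m' := fun m m' => by
      by_cases hN : m ≠ x ∧ m' ≠ x
      · rw [hfx m hN.1, hfx m' hN.2, colour_embedding]
        exact (colour_embedding Px.subtype (⟨m, hN.1⟩ : Px) (⟨m', hN.2⟩ : Px)).symm
      by_cases hP : m ≠ y ∧ m' ≠ y
      · rw [hfy m hP.1, hfy m' hP.2, colour_embedding]
        exact (colour_embedding Py.subtype (⟨m, hP.1⟩ : Py) (⟨m', hP.2⟩ : Py)).symm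
      have : (m = x ∧ m' = y) ∨ (m = y ∧ m' = x) := by grind
      rcases this with ⟨rfl, rfl⟩ | ⟨rfl, rfl⟩
      · exact colour_eq_of_unrelated hfu hu (hself _) (hself _)
      · exact colour_eq_of_unrelated hfu.symm hu.symm (hself _) (hself _)
    have hinj : Function.Injective f := by
      have key : ∀ m, f m = f x → m = x := fun m hm => by
        by_contra hmx
        rw [hfx m hmx, hfy x hxy] at hm
        obtain ⟨p, -, hp⟩ := hmeet _ _ hm
        exact p.2.1 (congrArg Subtype.val hp)
      intro m m' hmm
      by_cases hmx : m = x
      · subst hmx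
        exact (key m' hmm.symm).symm
      by_cases hmx' : m' = x
      · subst hmx'
        exact key m hmm
      rw [hfx m hmx, hfx m' hmx'] at hmm
      exact congrArg Subtype.val (NQ.injective hmm)
    exact hC₀.mem_of_embedding (embeddingOfColour hL₀ f hinj hcol) hQ

/-- The structure with given unary and binary relations. -/
@[reducible]
def pairStructure (L₀ : FirstOrder.Language.{u, v}) [L₀.IsRelational] {N : Type w}
    (U : L₀.Relations 1 → N → Prop) (B : L₀.Relations 2 → N → N → Prop) : L₀.Structure N where
  funMap := fun {_} g => isEmptyElim g
  RelMap := fun {n} => match n with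
    | 1 => fun R x => U R (x 0)
    | 2 => fun R x => B R (x 0) (x 1)
    | _ => fun _ _ => False

/-- Homogeneity and the realization of the finite ordered structures of a free amalgamation class
give the one-point extension property. -/
theorem isPairGeneric_of_universal (hL₀ : IsGraphVocabulary L₀) (hC₀ : IsFreeAmalgamationClass C₀)
    {A : Type w} [L₀.Structure A] [LinearOrder A] (G : Subgroup (Equiv.Perm A))
    (hirr : ∀ x : A, Unrelated L₀ x x)
    (hage : ∀ (Q : Type w) [L₀.Structure Q] [Finite Q] (_ : Q ↪[L₀] A),
      (⟨Q, inferInstance⟩ : CategoryTheory.Bundled.{w} L₀.Structure) ∈ C₀)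
    (hreal : ∀ (N : Type w) [L₀.Structure N] [Finite N] (r : N → N → Prop),
      IsStrictTotalOrder N r →
      (⟨N, inferInstance⟩ : CategoryTheory.Bundled.{w} L₀.Structure) ∈ C₀ →
      ∃ f : N ↪[L₀] A, ∀ x y, f x < f y ↔ r x y)
    (hmap : ∀ g ∈ G, ∀ x y, colour L₀ (g x) (g y) = colour L₀ x y ∧ (g x < g y ↔ x < y))
    (hom : ∀ P : Set (A × A), P.Finite →
      (∀ p ∈ P, ∀ q ∈ P, colour L₀ p.1 q.1 = colour L₀ p.2 q.2 ∧ (p.1 < q.1 ↔ p.2 < q.2)) →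
      ∃ g ∈ G, ∀ p ∈ P, g p.1 = p.2) :
    IsPairGeneric (colour L₀ (M := A)) (Unrelated L₀) G where
  c_symm := colour_symm
  c_diag := colour_self_eq hirr hirr
  unrel_symm := Unrelated.symm
  unrel_self := hirr
  c_of_unrel := colour_eq_of_unrelated
  map_c hg x y := (hmap _ hg x y).1
  map_lt hg x y := (hmap _ hg x y).2
  hom := hom
  ext := by
    classical
    intro X R C q a₀ hX hRX hC hqq hqc
    have : Finite X := hX
    let U : L₀.Relations 1 → Option X → Prop := fun r n =>
      Structure.RelMap r ![n.elim a₀ Subtype.val]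
    -- `none` is the new point: it is related to `y ∈ R` as `a₀` is to `q y`, and to nothing outside
    -- `R`.
    let B : L₀.Relations 2 → Option X → Option X → Prop := fun r n m =>
      match n, m with
      | none, none => False
      | some y, none => (y : A) ∈ R ∧ Structure.RelMap r ![q y, a₀]
      | none, some y => (y : A) ∈ R ∧ Structure.RelMap r ![a₀, q y]
      | some y, some z => Structure.RelMap r ![(y : A), (z : A)]
    let _ : L₀.Structure (Option X) := pairStructure L₀ U B
    have hU : ∀ (r : L₀.Relations 1) n, Structure.RelMap r ![n] ↔ U r n := fun _ _ => Iff.rfl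
    have hB : ∀ (r : L₀.Relations 2) n m, Structure.RelMap r ![n, m] ↔ B r n m :=
      fun _ _ _ => Iff.rfl
    have hss : ∀ y z : X, colour L₀ (some y : Option X) (some z) = colour L₀ (y : A) (z : A) :=
      fun y z => colour_eq_iff.2 ⟨fun _ => Iff.rfl, fun _ => Iff.rfl, fun _ => Iff.rfl,
        fun _ => Iff.rfl⟩
    have hnn : colour L₀ (none : Option X) none = colour L₀ a₀ a₀ := by
      refine colour_eq_iff.2 ⟨fun _ => Iff.rfl, fun _ => Iff.rfl, fun r => ?_, fun r => ?_⟩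
      · exact iff_of_false (fun h => h) (hirr a₀ r).1
      · exact iff_of_false (fun h => h) (hirr a₀ r).1
    have hns : ∀ y : X, (y : A) ∈ R →
        colour L₀ (none : Option X) (some y) = colour L₀ a₀ (q y) := fun y hy => by
      have h1 := (colour_eq_iff.1 (hqq y hy)).1
      refine colour_eq_iff.2 ⟨fun _ => Iff.rfl, fun r => (h1 r).symm, fun r => ?_, fun r => ?_⟩
      · rw [hB]
        exact and_iff_right hy
      · rw [hB]
        exact and_iff_right hy
    have hnu : ∀ y : X, (y : A) ∉ R → Unrelated L₀ (none : Option X) (some y) := fun y hy r => by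
      rw [hB, hB]
      exact ⟨fun h => hy h.1, fun h => hy h.1⟩
    have hirrN : ∀ n : Option X, Unrelated L₀ n n := by
      rintro (_ | y)
      · exact (hirr a₀).congr hnn.symm
      · exact (hirr (y : A)).congr (hss y y).symm
    -- Only cliques matter. One containing `none` has its other points in `R` and maps to `A` by
    -- `none ↦ a₀`, `y ↦ q y`. This is injective because related points cannot be identified in an
    -- irreflexive structure, so `q` need not be injective nor preserve unrelated pairs or the
    -- order.
    have hN : (⟨Option X, inferInstance⟩ : CategoryTheory.Bundled.{w} L₀.Structure) ∈ C₀ := by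
      refine hC₀.mem_of_cliques hL₀ _ (Option X) rfl hirrN fun Q _ e hQ => ?_
      have : Finite Q := Finite.of_injective e e.injective
      have hQe : ∀ x y, x ≠ y → ¬ Unrelated L₀ (e x) (e y) := fun x y hxy hu =>
        hQ x y hxy (hu.congr (colour_embedding e x y))
      suffices ∃ f : Option X → A, ∀ x y, colour L₀ (f (e x)) (f (e y)) =
          colour L₀ (e x) (e y) by
        obtain ⟨f, hf⟩ := this
        refine hage Q (embeddingOfColour hL₀ (f ∘ e) (fun x y hxy => ?_) fun x y =>
          (hf x y).trans (colour_embedding e x y))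
        by_contra hne
        refine hQe x y hne (Unrelated.congr (hf x y) ?_)
        have : f (e x) = f (e y) := hxy
        rw [this]
        exact hirr _
      by_cases hnone : none ∈ Set.range e
      · obtain ⟨x₀, hx₀⟩ := hnone
        have hmemR : ∀ x y, e x = some y → (y : A) ∈ R := by
          intro x y hxy
          by_contra hy
          refine hQe x₀ x (by rintro rfl; simp [hx₀] at hxy) ?_
          rw [hx₀, hxy]
          exact hnu y hy
        refine ⟨fun n => n.elim a₀ fun y => q y, fun x x' => ?_⟩
        rcases hx : e x with _ | y <;> rcases hx' : e x' with _ | z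
        · exact hnn.symm
        · exact (hns z (hmemR x' z hx')).symm
        · exact colour_symm (hns y (hmemR x y hx)).symm
        · rw [hss]
          rcases eq_or_ne x x' with rfl | hne
          · obtain rfl : y = z := Option.some.inj (hx.symm.trans hx')
            exact hqq y (hmemR x y hx)
          · refine hqc y (hmemR x y hx) z (hmemR x' z hx') fun hu => hQe x x' hne ?_
            rw [hx, hx']
            exact hu.congr (hss y z).symm
      · refine ⟨fun n => n.elim a₀ Subtype.val, fun x x' => ?_⟩
        rcases hx : e x with _ | y
        · exact absurd ⟨x, hx⟩ hnone
        rcases hx' : e x' with _ | z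
        · exact absurd ⟨x', hx'⟩ hnone
        exact (hss y z).symm
    let r : Option X → Option X → Prop := fun n m =>
      match n, m with
      | none, none => False
      | some y, none => (y : A) ∈ C
      | none, some y => (y : A) ∉ C
      | some y, some z => (y : A) < z
    have hr : IsStrictTotalOrder (Option X) r :=
      { trichotomous := by
          rintro (_ | y) (_ | z) h1 h2
          · rfl
          · exact absurd (not_not.1 h1) h2
          · exact absurd (not_not.1 h2) h1
          · exact congrArg some (Subtype.ext (le_antisymm (not_lt.1 h2) (not_lt.1 h1)))
        irrefl := by
          rintro (_ | y) h
          · exact h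
          · exact lt_irrefl _ h
        trans := by
          rintro (_ | x) (_ | y) (_ | z) h1 h2
          · exact h1
          · exact h2
          · exact h1 h2
          · exact fun hz => h1 (hC z z.2 y y.2 h2 hz)
          · exact h1
          · refine lt_of_not_ge fun hzx => h2 ?_
            rcases hzx.lt_or_eq with h | h
            · exact hC x x.2 z z.2 h h1
            · exact h ▸ h1
          · exact hC y y.2 x x.2 h1 h2
          · exact lt_trans h1 h2 }
    obtain ⟨f, hf⟩ := hreal (Option X) r hr hN
    -- The realization `f` places `X` somewhere in `A`; homogeneity moves it back to its original
    -- position.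
    obtain ⟨g, hg, hgP⟩ := hom (Set.range fun y : X => (f (some y), (y : A)))
      (Set.finite_range _) (by
        rintro _ ⟨y, rfl⟩ _ ⟨z, rfl⟩
        exact ⟨(colour_embedding f _ _).trans (hss y z), hf _ _⟩)
    have hgy : ∀ y : X, g (f (some y)) = y := fun y => hgP _ ⟨y, rfl⟩
    have hcol : ∀ n m, colour L₀ (g (f n)) (g (f m)) = colour L₀ n m := fun n m =>
      (hmap g hg _ _).1.trans (colour_embedding f n m)
    refine ⟨g (f none), fun hb => ?_, (hcol _ _).trans hnn, fun y hy => ?_, fun y hy hyR => ?_,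
      fun y hy => ?_⟩
    · have := f.injective (g.injective (hgy ⟨_, hb⟩))
      simp at this
    · have := hcol none (some ⟨y, hRX hy⟩)
      rw [hgy] at this
      exact this.trans (hns ⟨y, hRX hy⟩ hy)
    · have := hcol none (some ⟨y, hy⟩)
      rw [hgy] at this
      exact (hnu ⟨y, hy⟩ hyR).congr this.symm
    · have h1 := (hmap g hg (f (some ⟨y, hy⟩)) (f none)).2.trans (hf _ _)
      rw [hgy] at h1
      exact h1

end Classes

/-! ### The Fraïssé limit satisfies the axioms -/

section FraisseLimit

variable {L₀ : FirstOrder.Language.{u, v}} [L₀.IsRelational]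
  {C₀ : Set (CategoryTheory.Bundled.{w} L₀.Structure)} {A : Type w} [(withLt L₀).Structure A]

theorem setSubstructure_mem (hage : (withLt L₀).age A = orderedExpansions C₀) {s : Set A}
    (hs : s.Finite) :
    (⟨setSubstructure (withLt L₀) s, inferInstance⟩ :
      CategoryTheory.Bundled.{w} (withLt L₀).Structure) ∈ orderedExpansions C₀ := by
  rw [← hage]
  refine age.fg_substructure (Substructure.fg_iff_finite.2 ?_)
  exact hs.to_subtype

theorem lt_setSubstructure {s : Set A} (x y : setSubstructure (withLt L₀) s) :
    Lt L₀ x y ↔ Lt L₀ (x : A) (y : A) := by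
  have h := (setSubstructure (withLt L₀) s).subtype.map_rel (ltSymb L₀) ![x, y]
  have h2 : ![(x : A), (y : A)] = (setSubstructure (withLt L₀) s).subtype ∘ ![x, y] := by
    ext i
    fin_cases i <;> rfl
  rw [Lt, Lt, h2]
  exact h.symm

theorem isStrictTotalOrder_of_age (hage : (withLt L₀).age A = orderedExpansions C₀) :
    IsStrictTotalOrder A (Lt L₀) where
  trichotomous a b h1 h2 := by
    have := (setSubstructure_mem hage (Set.toFinite {a, b})).2
    have := this.trichotomous ⟨a, .inl rfl⟩ ⟨b, .inr rfl⟩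
      (by rwa [lt_setSubstructure]) (by rwa [lt_setSubstructure])
    exact congrArg Subtype.val this
  irrefl a h := by
    have := (setSubstructure_mem hage (Set.toFinite {a})).2
    exact this.irrefl ⟨a, rfl⟩ (by rwa [lt_setSubstructure])
  trans a b d h1 h2 := by
    have := (setSubstructure_mem hage (Set.toFinite {a, b, d})).2
    have := this.trans ⟨a, .inl rfl⟩ ⟨b, .inr (.inl rfl)⟩ ⟨d, .inr (.inr rfl)⟩
      (by rwa [lt_setSubstructure]) (by rwa [lt_setSubstructure])
    rwa [lt_setSubstructure] at this

/-- The age supplies realizations of all finite ordered members of the class, and ultrahomogeneity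
extends finite maps that preserve colours and order. -/
theorem isPairGeneric_of_isFraisseLimit (hL₀ : IsGraphVocabulary L₀)
    (hC₀ : IsFreeAmalgamationClass C₀) (hirr : IrreflexiveClass C₀)
    (hhom : (withLt L₀).IsUltrahomogeneous A)
    (hage : (withLt L₀).age A = orderedExpansions C₀) [LinearOrder A] [L₀.Structure A]
    (hlt : ∀ x y : A, x < y ↔ Lt L₀ x y)
    (hred : ∀ {n : ℕ} (R : L₀.Relations n) (x : Fin n → A),
      Structure.RelMap (L := withLt L₀) (Sum.inl R) x ↔ Structure.RelMap R x) :
    IsPairGeneric (colour L₀ (M := A)) (Unrelated L₀) (autFixing (withLt L₀) (∅ : Set A)) := by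
  have hmem : ∀ (Q : Type w) [L₀.Structure Q] [Finite Q] (_ : Q ↪[L₀] A),
      (⟨Q, inferInstance⟩ : CategoryTheory.Bundled.{w} L₀.Structure) ∈ C₀ := by
    intro Q _ _ e
    have hT := (setSubstructure_mem hage (Set.finite_range e)).1
    let _ : L₀.Structure (setSubstructure (withLt L₀) (Set.range e)) :=
      (LHom.sumInl : L₀ →ᴸ withLt L₀).reduct _
    refine hC₀.mem_of_embedding (N := setSubstructure (withLt L₀) (Set.range e))
      { toFun := fun q => ⟨e q, q, rfl⟩
        inj' := fun q q' h => e.injective (congrArg Subtype.val h)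
        map_fun' := fun {_} g => isEmptyElim g
        map_rel' := fun R x => (hred R (e ∘ x)).trans (e.map_rel R x) } hT
  have hloop : ∀ x : A, Unrelated L₀ x x := by
    intro x R
    have : Finite (setSubstructure L₀ {x}) := inferInstanceAs (Finite ({x} : Set A))
    have := hirr _ (hmem (setSubstructure L₀ {x}) (setSubstructure L₀ {x}).subtype) R ⟨x, rfl⟩
    have h2 : ¬ Structure.RelMap R ![x, x] := by
      rw [← (setSubstructure L₀ {x}).subtype.map_rel] at this
      convert this using 2
      ext i
      fin_cases i <;> rfl
    exact ⟨h2, h2⟩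
  refine isPairGeneric_of_universal hL₀ hC₀ _ hloop hmem ?_ ?_ ?_
  · intro N _ _ r hr hN
    let _ : ltLanguage.Structure N :=
      { funMap := fun {_} g => isEmptyElim g
        RelMap := fun {_} s => match s with
          | LtSymbol.lt => fun x => r (x 0) (x 1) }
    have hNK : (⟨N, inferInstance⟩ : CategoryTheory.Bundled.{w} (withLt L₀).Structure) ∈
        (withLt L₀).age A := by
      rw [hage]
      exact ⟨hN, hr⟩
    obtain ⟨-, ⟨e⟩⟩ := hNK
    refine ⟨⟨e.toEmbedding, fun {_} g => isEmptyElim g, fun R x => ?_⟩, fun x y => ?_⟩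
    · exact (hred R (e ∘ x)).symm.trans (e.map_rel (Sum.inl R) x)
    · rw [hlt, Lt]
      have h2 : ![e x, e y] = e ∘ ![x, y] := by
        ext i
        fin_cases i <;> rfl
      change Structure.RelMap (ltSymb L₀) ![e x, e y] ↔ _
      rw [h2, e.map_rel]
      rfl
  · rintro _ ⟨⟨e, rfl⟩, -⟩ x y
    let e' : A ↪[L₀] A := ⟨e.toEquiv.toEmbedding, fun {_} g => isEmptyElim g, fun R x =>
      (hred R (e ∘ x)).symm.trans ((e.map_rel (Sum.inl R) x).trans (hred R x))⟩
    refine ⟨colour_embedding e' x y, ?_⟩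
    rw [hlt, hlt, Lt, Lt]
    have h2 : ![e x, e y] = e ∘ ![x, y] := by
      ext i
      fin_cases i <;> rfl
    change Structure.RelMap (ltSymb L₀) ![e x, e y] ↔ _
    rw [h2, e.map_rel]
  · intro P hP hPP
    let s : Set A := Prod.fst '' P
    have hex : ∀ x : setSubstructure (withLt L₀) s, ∃ y, ((x : A), y) ∈ P := by
      rintro ⟨_, p, hp, rfl⟩
      exact ⟨p.2, hp⟩
    choose f hf using hex
    -- Preservation of `<` makes `P` the graph of a function: two values at the same point are
    -- incomparable, hence equal.
    have hfP : ∀ p (hp : p ∈ P), f ⟨p.1, p, hp, rfl⟩ = p.2 := fun p hp => by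
      have h1 := (hPP _ (hf ⟨p.1, p, hp, rfl⟩) p hp).2
      have h2 := (hPP p hp _ (hf ⟨p.1, p, hp, rfl⟩)).2
      simp only [lt_self_iff_false, false_iff, not_lt] at h1 h2
      exact le_antisymm h2 h1
    have hlt' : ∀ x y : setSubstructure (withLt L₀) s, f x < f y ↔ (x : A) < y := fun x y => ((hPP _ (hf x) _ (hf y)).2).symm
    have hinj : Function.Injective f := fun x y hxy => by
      refine Subtype.ext (le_antisymm (not_lt.1 fun h => ?_) (not_lt.1 fun h => ?_))
      · exact ((hlt' _ _).2 h).ne hxy.symm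
      · exact ((hlt' _ _).2 h).ne hxy
    let e : setSubstructure (withLt L₀) s ↪[withLt L₀] A :=
      { toFun := f
        inj' := hinj
        map_fun' := fun {_} g => isEmptyElim g
        map_rel' := fun {n} R x => by
          rcases R with R | R
          · have := relMap_comp_iff hL₀ (M := setSubstructure L₀ s) (f := f) (fun x y =>
              ((hPP _ (hf x) _ (hf y)).1.symm.trans
                (colour_embedding (setSubstructure L₀ s).subtype x y))) R x
            refine (hred R _).trans (this.trans ?_)
            exact (hred R (fun i => (x i : A))).symm
          · cases R with
            | lt =>
              have h1 : x = ![x 0, x 1] := by ext i; fin_cases i <;> rfl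
              have h2 : f ∘ x = ![f (x 0), f (x 1)] := by ext i; fin_cases i <;> rfl
              change Structure.RelMap (ltSymb L₀) (f ∘ x) ↔ Structure.RelMap (ltSymb L₀) x
              rw [h2]
              conv_rhs => rw [h1]
              exact (hlt _ _).symm.trans ((hlt' _ _).trans ((hlt _ _).trans
                (lt_setSubstructure _ _).symm)) }
    obtain ⟨g, hg⟩ := hhom (setSubstructure (withLt L₀) s)
      (Substructure.fg_iff_finite.2 (hP.image _).to_subtype) e
    refine ⟨g.toEquiv, ⟨⟨g, rfl⟩, by simp⟩, fun p hp => ?_⟩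
    rw [← hfP p hp]
    exact (DFunLike.congr_fun hg ⟨p.1, p, hp, rfl⟩).symm

end FraisseLimit

/-! ### Computing the length from a filtration -/

section Filtration

/-- A finite family of subrepresentations whose successive intersections form a filtration with
simple quotients computes the length. -/
theorem krullDim_subrepresentation_eq {F H V : Type*} [Field F] [Group H] [AddCommGroup V]
    [Module F V] {ρ : Representation F H V} {n : ℕ} (T : Fin n → Subrepresentation ρ)
    (hzero : ∀ v, (∀ j, v ∈ T j) → v = 0)
    (hne : ∀ k, ∃ v, (∀ j < k, v ∈ T j) ∧ v ∉ T k)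
    (hsimple : ∀ k (W : Subrepresentation ρ), ∀ w ∈ W, (∀ j < k, w ∈ T j) → w ∉ T k →
      ∀ w', (∀ j < k, w' ∈ T j) → ∃ w'' ∈ W, (∀ j < k, w'' ∈ T j) ∧ w' - w'' ∈ T k) :
    Order.krullDim (Subrepresentation ρ) = (n : WithBot ℕ∞) := by
  classical
  have hsub : ∀ (W : Subrepresentation ρ) (x y : V), x ∈ W → y ∈ W → x - y ∈ W :=
    fun W x y hx hy => W.toSubmodule.sub_mem hx hy
  have hadd : ∀ (W : Subrepresentation ρ) (x y : V), x ∈ W → y ∈ W → x + y ∈ W :=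
    fun W x y hx hy => W.toSubmodule.add_mem hx hy
  apply le_antisymm
  -- `φ W` is the set of filtration steps at which `W` has a nonzero image. A strictly larger
  -- subspace must gain a step, so chains have length at most `n`.
  · let φ : Subrepresentation ρ → Finset (Fin n) := fun W =>
      Finset.univ.filter fun k => ∃ w ∈ W, (∀ j < k, w ∈ T j) ∧ w ∉ T k
    have hφ : ∀ W k, k ∈ φ W ↔ ∃ w ∈ W, (∀ j < k, w ∈ T j) ∧ w ∉ T k := fun W k => by simp [φ]
    have hmono : StrictMono fun W => (φ W).card := by
      intro W W' hW
      have hle : φ W ⊆ φ W' := fun k hk => by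
        obtain ⟨w, hw, h⟩ := (hφ W k).1 hk
        exact (hφ W' k).2 ⟨w, hW.le hw, h⟩
      by_contra hcard
      have heq := Finset.eq_of_subset_of_card_le hle (not_lt.1 hcard)
      -- Descending induction along the filtration: if `φ W = φ W'`, simplicity lets an element of
      -- `W'` be corrected by one of `W` into the next step, until it becomes zero.
      have key : ∀ i m, m + i = n → ∀ w' ∈ W', (∀ j : Fin n, j.val < m → w' ∈ T j) → w' ∈ W := by
        intro i
        induction i with
        | zero =>
          rintro m rfl w' - h
          rw [hzero w' fun j => h j j.2]
          exact W.toSubmodule.zero_mem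
        | succ i ih =>
          intro m hm w' hw' h
          have hmn : m < n := by omega
          by_cases hk : w' ∈ T ⟨m, hmn⟩
          · refine ih (m + 1) (by omega) w' hw' fun j hj => ?_
            rcases Nat.lt_succ_iff_lt_or_eq.1 hj with hj' | hj'
            · exact h j hj'
            · obtain rfl : j = ⟨m, hmn⟩ := Fin.ext hj'
              exact hk
          · have : (⟨m, hmn⟩ : Fin n) ∈ φ W := by
              rw [heq]
              exact (hφ _ _).2 ⟨w', hw', fun j hj => h j hj, hk⟩
            obtain ⟨w, hw, hw1, hw2⟩ := (hφ _ _).1 this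
            obtain ⟨w'', hw'', h1, h2⟩ := hsimple _ W w hw hw1 hw2 w' fun j hj => h j hj
            have h3 : w' - w'' ∈ W := by
              refine ih (m + 1) (by omega) _ (hsub _ _ _ hw' (hW.le hw'')) fun j hj => ?_
              rcases Nat.lt_succ_iff_lt_or_eq.1 hj with hj' | hj'
              · exact hsub _ _ _ (h j hj') (h1 j hj')
              · obtain rfl : j = ⟨m, hmn⟩ := Fin.ext hj'
                exact h2
            simpa using hadd _ _ _ h3 hw''
      exact hW.not_ge fun w' hw' => key n 0 (by simp) w' hw' fun j hj => absurd hj (by simp)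
    refine iSup_le fun p => ?_
    have h1 := (p.map _ hmono).head_add_length_le_nat
    have h2 : (p.map _ hmono).last ≤ n := by
      simpa using (φ p.last).card_le_univ
    have h3 : p.length ≤ n := by
      simp only [LTSeries.map_length] at h1
      omega
    exact_mod_cast h3
  · let U : ℕ → Subrepresentation ρ := fun m =>
      { toSubmodule := ⨅ j : {j : Fin n // j.val < m}, (T j).toSubmodule
        apply_mem_toSubmodule := fun g v hv => by
          rw [Submodule.mem_iInf] at *
          exact fun j => (T j).apply_mem_toSubmodule g (hv j) }
    have hU : ∀ m v, v ∈ U m ↔ ∀ j : Fin n, j.val < m → v ∈ T j := fun m v => by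
      change v ∈ ⨅ j : {j : Fin n // j.val < m}, (T j).toSubmodule ↔ _
      rw [Submodule.mem_iInf]
      exact ⟨fun h j hj => h ⟨j, hj⟩, fun h j => h j j.2⟩
    have hmono : StrictMono fun k : Fin (n + 1) => U (n - k.val) := by
      refine Fin.strictMono_iff_lt_succ.2 fun k => lt_of_le_not_ge ?_ ?_
      · intro v hv
        rw [hU] at *
        exact fun j hj => hv j (by simp at *; omega)
      · intro hle
        have hk : n - k.val - 1 < n := by omega
        obtain ⟨v, hv, hv'⟩ := hne ⟨n - k.val - 1, hk⟩
        have h1 : v ∈ U (n - k.succ.val) := by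
          rw [hU]
          exact fun j hj => hv j (by
            rw [Fin.lt_def]
            simp at hj ⊢
            omega)
        refine hv' ((hU _ _).1 (hle h1) _ ?_)
        change n - k.val - 1 < n - k.val
        omega
    exact Order.LTSeries.length_le_krullDim (LTSeries.mk n _ hmono)

end Filtration

/-! ### Projections to sets of coordinates -/

section Projection

variable {A ι : Type*} (F : Type*) [Field F] {H : Subgroup (Equiv.Perm A)} {o : ι → A}

/-- Projection of formal combinations of tuples to the coordinates in `I`. -/
noncomputable def proj (H : Subgroup (Equiv.Perm A)) (o : ι → A) (I : Finset ι) :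
    (MulAction.orbit H o →₀ F) →ₗ[F] ((I → A) →₀ F) :=
  Finsupp.lmapDomain F F fun a i => a.1 i

variable {F}

theorem proj_linRep (I : Finset ι) (g : H) (v : MulAction.orbit H o →₀ F) :
    proj F H o I (linRep F H _ g v) = act F (g : Equiv.Perm A) (proj F H o I v) := by
  induction v using Finsupp.induction_linear with
  | zero => simp
  | add v w hv hw => simp only [map_add, hv, hw]
  | single a r =>
    simp only [proj, linRep, MonoidHom.coe_mk, OneHom.coe_mk, Finsupp.lmapDomain_apply,
      Finsupp.mapDomain_single, act]
    rfl

/-- Writing a constant into coordinate `i` factors through forgetting that coordinate. This turns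
vanishing projections into the cycle condition. -/
theorem upd_proj [DecidableEq ι] {I : Finset ι} (i : I) (x : A) {v : MulAction.orbit H o →₀ F}
    (hv : proj F H o (I.erase i) v = 0) : upd F i x (proj F H o I v) = 0 := by
  have : upd F i x (proj F H o I v) = Finsupp.mapDomain (fun (t : I.erase i → A) (j : I) =>
      if h : j = i then x else t ⟨j, Finset.mem_erase.2 ⟨fun h' => h (Subtype.ext h'), j.2⟩⟩)
      (proj F H o (I.erase i) v) := by
    rw [upd, proj, proj, Finsupp.lmapDomain_apply, Finsupp.lmapDomain_apply,
      Finsupp.lmapDomain_apply, ← Finsupp.mapDomain_comp, ← Finsupp.mapDomain_comp]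
    congr 1
    ext a j
    by_cases h : j = i
    · subst h
      simp
    · simp [h]
  rw [this, hv, Finsupp.mapDomain_zero]

end Projection

/-! ### The length of an orbit -/

section Orbit

variable {A τ ι F : Type*} [LinearOrder A] {c : A → A → τ} {unrel : A → A → Prop}
  {G H : Subgroup (Equiv.Perm A)} [Field F] {S : Set A} {o : ι → A}

theorem sameType_of_mem_orbit (hG : IsPairGeneric c unrel G)
    (hH : ∀ g, g ∈ H ↔ g ∈ G ∧ ∀ s ∈ S, g s = s) {a : ι → A} (ha : a ∈ MulAction.orbit H o) :
    SameType c S o a := by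
  obtain ⟨g, rfl⟩ := ha
  exact hG.sameType_map ((hH g).1 g.2).1 ((hH g).1 g.2).2 (SameType.refl S o)

theorem mem_orbit_of_sameType [Finite ι] (hG : IsPairGeneric c unrel G) (hS : S.Finite)
    (hH : ∀ g, g ∈ H ↔ g ∈ G ∧ ∀ s ∈ S, g s = s) {a : ι → A} (ha : SameType c S o a) :
    a ∈ MulAction.orbit H o := by
  obtain ⟨g, hg, hgS, hga⟩ := hG.exists_map hS ha
  exact ⟨⟨g, (hH g).2 ⟨hg, hgS⟩⟩, funext hga⟩

theorem sameType_of_mem_support_proj (hG : IsPairGeneric c unrel G)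
    (hH : ∀ g, g ∈ H ↔ g ∈ G ∧ ∀ s ∈ S, g s = s) {I : Finset ι} (v : MulAction.orbit H o →₀ F)
    {t : I → A} (ht : t ∈ (proj F H o I v).support) : SameType c S (fun i : I => o i) t := by
  classical
  obtain ⟨a, -, rfl⟩ := Finset.mem_image.1 (Finsupp.mapDomain_support ht)
  have := sameType_of_mem_orbit hG hH a.2
  exact ⟨fun j k => this.1 j k, fun j => this.2 j⟩

variable [LinearOrder ι] [Fintype ι]

/-- Take a free cog in the coordinates `I` starting at `o`. On `I` the term `o` survives since `o i
≠ b i`; if `J` misses some `i ∈ I`, the terms cancel in pairs differing only at `i`. -/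
theorem exists_proj_ne_zero (hG : IsPairGeneric c unrel G) (hS : S.Finite)
    (ho : IsIncreasing S o) (hH : ∀ g, g ∈ H ↔ g ∈ G ∧ ∀ s ∈ S, g s = s) (I : Finset ι) :
    ∃ v, proj F H o I v ≠ 0 ∧ ∀ J : Finset ι, ¬ I ⊆ J → proj F H o J v = 0 := by
  -- Applied with `W = ⊤` solely to obtain the partner tuple `b`.
  obtain ⟨b, hb, hfree, -⟩ := exists_cog_mem (F := F) hG hS ho (W := ⊤) (a := o)
    (fun _ _ _ _ _ => trivial) (w := Finsupp.single o 1) trivial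
    (fun a ha => by
      obtain rfl : a = o := by simpa using Finsupp.support_single_subset ha
      exact SameType.refl S a) (by simp)
  let v : MulAction.orbit H o →₀ F := ∑ e ∈ I.powerset, (-1 : F) ^ e.card •
    Finsupp.single ⟨e.piecewise b o, mem_orbit_of_sameType hG hS hH (hb.sameType e)⟩ 1
  have hv : ∀ J, proj F H o J v =
      Finsupp.lmapDomain F F (fun (a : ι → A) (i : J) => a i) (cog F I o b) := fun J => by
    rw [cog, map_sum, map_sum]
    refine Finset.sum_congr rfl fun e _ => ?_
    rw [map_smul, map_smul, proj, Finsupp.lmapDomain_apply, Finsupp.lmapDomain_apply,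
      Finsupp.mapDomain_single, Finsupp.mapDomain_single]
  refine ⟨v, fun h => ?_, fun J hJ => ?_⟩
  · have h1 := DFunLike.congr_fun h fun i : I => o i
    rw [hv, cog, map_sum, Finsupp.finsetSum_apply, Finset.sum_eq_single ∅] at h1
    · simp at h1
    · intro e he hne
      obtain ⟨i, hi⟩ := Finset.nonempty_iff_ne_empty.2 hne
      rw [map_smul, Finsupp.lmapDomain_apply, Finsupp.mapDomain_single, Finsupp.smul_apply,
        Finsupp.single_eq_of_ne, smul_zero]
      intro heq
      have := congrFun heq ⟨i, Finset.mem_powerset.1 he hi⟩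
      simp only [Finset.piecewise_eq_of_mem _ _ _ hi] at this
      exact (hfree i).2.ne this
    · simp
  · obtain ⟨i, hiI, hiJ⟩ := Finset.not_subset.1 hJ
    rw [hv, ← Finset.insert_erase hiI, cog_insert (Finset.notMem_erase i I), map_sub, sub_eq_zero,
      upd, Finsupp.lmapDomain_apply, Finsupp.lmapDomain_apply, Finsupp.lmapDomain_apply,
      ← Finsupp.mapDomain_comp]
    congr 1
    ext a j
    have : (j : ι) ≠ i := by
      rintro h
      exact hiJ (h ▸ j.2)
    simp [this]

theorem linLength_orbit (hG : IsPairGeneric c unrel G) (hS : S.Finite)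
    (ho : IsIncreasing S o) (hH : ∀ g, g ∈ H ↔ g ∈ G ∧ ∀ s ∈ S, g s = s) :
    linLength F H (MulAction.orbit H o) = ((2 ^ Fintype.card ι : ℕ) : WithBot ℕ∞) := by
  classical
  let _ : Fintype (Colex (Finset ι)) := Fintype.ofEquiv _ toColex
  -- The colexicographic order is a linear extension of inclusion, so all proper subsets of a set
  -- precede it.
  let e : Fin (2 ^ Fintype.card ι) ≃o Colex (Finset ι) := Fintype.orderIsoFinOfCardEq _ (by
    rw [← Fintype.card_finset]
    exact (Fintype.card_congr toColex).symm)
  let I : Fin (2 ^ Fintype.card ι) → Finset ι := fun k => ofColex (e k)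
  have hIe : ∀ J, I (e.symm (toColex J)) = J := fun J => by simp [I]
  have hlt : ∀ k (J : Finset ι), J ⊂ I k → e.symm (toColex J) < k := fun k J hJ => by
    rw [← e.lt_iff_lt, OrderIso.apply_symm_apply]
    exact Finset.Colex.toColex_lt_toColex_of_ssubset hJ
  let T : Fin (2 ^ Fintype.card ι) → Subrepresentation (linRep F H (MulAction.orbit H o)) :=
    fun k =>
      { toSubmodule := LinearMap.ker (proj F H o (I k))
        apply_mem_toSubmodule := fun g v hv => by
          rw [LinearMap.mem_ker] at *
          rw [proj_linRep, hv, map_zero] }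
  have hT : ∀ k v, v ∈ T k ↔ proj F H o (I k) v = 0 := fun k v => Iff.rfl
  refine krullDim_subrepresentation_eq T (fun v hv => ?_) (fun k => ?_) ?_
  · have h1 := (hT _ _).1 (hv (e.symm (toColex Finset.univ)))
    rw [hIe] at h1
    refine Finsupp.mapDomain_injective (fun a b hab => Subtype.ext (funext fun i => ?_))
      (h1.trans Finsupp.mapDomain_zero.symm)
    exact congrFun hab ⟨i, Finset.mem_univ i⟩
  · obtain ⟨v, hv, hv'⟩ := exists_proj_ne_zero (F := F) hG hS ho hH (I k)
    refine ⟨v, fun j hj => (hT _ _).2 (hv' _ fun hsub => ?_), hv⟩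
    have : e k ≤ e j := Finset.Colex.toColex_le_toColex_of_subset hsub
    exact hj.not_ge (e.le_iff_le.1 this)
  · intro k W w hw hwT hwk w' hwT'
    let W₁ : Submodule F (MulAction.orbit H o →₀ F) :=
      W.toSubmodule ⊓ ⨅ j : {j // j < k}, (T j).toSubmodule
    have hW₁ : ∀ v, v ∈ W₁ ↔ v ∈ W ∧ ∀ j < k, v ∈ T j := fun v => by
      rw [Submodule.mem_inf, Submodule.mem_iInf]
      exact and_congr Iff.rfl ⟨fun h j hj => h ⟨j, hj⟩, fun h j => h j j.2⟩
    -- The part of `W` in the current filtration step projects to an invariant space of combinations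
    -- of `I k`-tuples. It is nonzero because of `w`, hence contains all cycles, among them the
    -- projection of `w'`.
    have hinv : IsInvariant G S (W₁.map (proj F H o (I k))) := by
      rintro g hg hgS _ ⟨v, hv, rfl⟩
      obtain ⟨h1, h2⟩ := (hW₁ v).1 hv
      refine ⟨linRep F H _ ⟨g, (hH g).2 ⟨hg, hgS⟩⟩ v, (hW₁ _).2 ⟨?_, fun j hj => ?_⟩, ?_⟩
      · exact W.apply_mem_toSubmodule _ h1
      · exact (T j).apply_mem_toSubmodule _ (h2 j hj)
      · rw [proj_linRep]
    have hcyc : IsCycle F c S Finset.univ (fun i : I k => o i) (proj F H o (I k) w') := by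
      refine ⟨fun t ht => sameType_of_mem_support_proj hG hH w' ht, by simp, fun i _ x => ?_⟩
      refine upd_proj i x ?_
      have := (hT _ _).1 (hwT' _ (hlt k _ (Finset.erase_ssubset i.2)))
      rwa [hIe] at this
    obtain ⟨w'', hw'', h⟩ := hcyc.mem_of_invariant hG hS (o := fun i : I k => o i)
      (w := proj F H o (I k) w)
      ⟨fun i j hij => ho.1 hij, fun i => ho.2 i⟩ hinv
      (Submodule.mem_map_of_mem ((hW₁ w).2 ⟨hw, hwT⟩)) hwk fun t ht => sameType_of_mem_support_proj hG hH w ht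
    obtain ⟨h1, h2⟩ := (hW₁ w'').1 hw''
    exact ⟨w'', h1, h2, (hT _ _).2 (by rw [map_sub, h, sub_self])⟩

end Orbit

end GenericOrder

theorem corollary8p4 {L₀ : FirstOrder.Language.{u, v}} [L₀.IsRelational]
    (hL₀ : GenericOrder.IsGraphVocabulary L₀)
    (C₀ : Set (CategoryTheory.Bundled.{w} L₀.Structure))
    (hC₀ : GenericOrder.IsFreeAmalgamationClass C₀)
    (hirr : GenericOrder.IrreflexiveClass C₀)
    (A : Type w) [(GenericOrder.withLt L₀).Structure A] [Countable A]
    (hA : FirstOrder.Language.IsFraisseLimit (GenericOrder.orderedExpansions C₀) A)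
    (F : Type*) [Field F] (S : Set A) (hS : S.Finite) (d : ℕ)
    (o : Fin d → A) (ho : GenericOrder.IsOrderedTuple L₀ S o) :
    GenericOrder.linLength F (GenericOrder.autFixing (GenericOrder.withLt L₀) S)
      (MulAction.orbit (GenericOrder.autFixing (GenericOrder.withLt L₀) S) o) =
        ((2 ^ d : ℕ) : WithBot ℕ∞) := by
  classical
  have hsto := GenericOrder.isStrictTotalOrder_of_age hA.age
  let _ : LinearOrder A := linearOrderOfSTO (GenericOrder.Lt L₀)
  let _ : L₀.Structure A := (LHom.sumInl : L₀ →ᴸ GenericOrder.withLt L₀).reduct A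
  have hG := GenericOrder.isPairGeneric_of_isFraisseLimit hL₀ hC₀ hirr hA.ultrahomogeneous hA.age
    (fun _ _ => Iff.rfl) (fun _ _ => Iff.rfl)
  have := GenericOrder.linLength_orbit (F := F) hG hS (o := o) ⟨fun i j => ho.2 i j, ho.1⟩
    (H := GenericOrder.autFixing (GenericOrder.withLt L₀) S)
    fun g => ⟨fun h => ⟨⟨h.1, by simp⟩, h.2⟩, fun h => ⟨h.1.1, h.2⟩⟩
  rwa [Fintype.card_fin] at this
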